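/- **Example (time-periodic heat equation).** Let $Y=L^2(0,\pi)$ (real), $U=\mathbb R$, $T=\pi$. Let $A=\Delta$ with domain $D(A)=H^2(0,\pi)\cap H^1_0(0,\pi)$, $D(t)=3\sin^2 t\, I_Y$, and $B:U\to Y$, $B\alpha=\alpha\sin x$. Consider the controlled heat equation $$y_t-(\Delta+3\sin^2 t)\,y=u(t)\sin x\ \text{ in }(0,\pi)\times(0,\infty),\qquad y(0,t)=y(\pi,t)=0,\qquad y(\cdot,0)\in L^2(0,\pi),$$ written as $y'(t)=(A+D(t))y(t)+Bu(t)$, $t\ge 0$, with controls $u\in L^2(0,\infty;\mathbb R)$. Solutions are mild: if $S(\cdot)$ is the $C_0$-semigroup generated by $A$, the evolution system $\Phi(t,s)$, $0\le s\le t$, of $A+D(\cdot)$ is the strongly continuous evolution family with $\Phi(t,s)z=S(t-s)z+\int_s^tS(t-r)D(r)\Phi(r,s)z\,dr$ (and similarly with another locally integrable perturbation in place of $D(\cdot)$), and the solution with $y(s)=z$ is $y(t;s,z,u)=\Phi(t,s)z+\int_s^t\Phi(t,r)Bu(r)\,dr$. For $n\ge1$ and $\psi\in Y$, $\varphi_n(\cdot;\psi)$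 denotes the mild solution of $\dot\varphi=-(A+D(t))^*\varphi$ on $[0,nT]$, $\varphi(nT)=\psi$, i.e. $\varphi(t)=S(nT-t)^*\psi+\int_t^{nT}S(r-t)^*D(r)^*\varphi(r)\,dr$. Then: 1. $T>0$, $A$ generates a $C_0$-semigroup on $Y$, $D(\cdot)\in L^1_{loc}([0,\infty);\mathcal L(Y))$ and $B\in L^\infty(0,\infty;\mathcal L(U,Y))$ are $T$-periodic, the evolution system $\Phi$ of $A+D(\cdot)$ exists, and the adjoint equation has a solution for all $n\ge1$ and $\psi\in Y$. 2. With zero control the system is unstable: there are no $M,\omega>0$ with $\|\Phi(t,s)z\|\le Me^{-\omega(t-s)}\|z\|$ for all $z\in Y$, $t\ge s\ge0$; moreover, for some $z\in Y$, $\|y(t;0,z,0)\|\to\infty$ as $t\to\infty$. 3. It is not null controllable: there is $z\in Y$ such that $y(\tau;0,z,u)\ne0$ for all $\tau>0$ and all $u\in L^2(0,\infty;\mathbb R)$. 4. The detectability inequality holds with $\delta=e^{-\pi}\in(0,1)$, $n=1$, $C=2e^{2\pi}$: $$\|\varphi_1(0;\psi)\|\le e^{-\pi}\|\psi\|+2e^{2\pi}\Big(\int_0^{\pi}|B^*\varphi_1(t;\psi)|^2\,dt\Big)^{1/2}\qquad\text{for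 all }\psi\in Y.$$ 5. The system is periodically stabilizable: there is $K\in L^\infty(0,\infty;\mathcal L(Y,U))$ with $K(t+T)=K(t)$ for a.e. $t>0$ such that the evolution system $\Phi_K$ of $A+D(\cdot)+BK(\cdot)$ exists and satisfies $\|\Phi_K(t,s)z\|\le Me^{-\omega(t-s)}\|z\|$ for some $M,\omega>0$ and all $z\in Y$, $t\ge s\ge 0$. -/

import Mathlib

open MeasureTheory Set Filter Topology
open scoped ContDiff InnerProductSpace

noncomputable section

namespace PeriodicStab

/-! ### Linear time-periodic control systems on real Hilbert spaces -/

section Abstract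

variable {Y U : Type*}
  [NormedAddCommGroup Y] [InnerProductSpace ℝ Y] [CompleteSpace Y]
  [NormedAddCommGroup U] [InnerProductSpace ℝ U] [CompleteSpace U]

/-- `S` (only its values at times `t ≥ 0` matter) is a strongly continuous one-parameter semigroup
of bounded operators. -/
structure IsC0Semigroup (S : ℝ → Y →L[ℝ] Y) : Prop where
  zero : S 0 = ContinuousLinearMap.id ℝ Y
  add : ∀ s t : ℝ, 0 ≤ s → 0 ≤ t → S (s + t) = (S s).comp (S t)
  tendsto_zero : ∀ z : Y, Tendsto (fun t => S t z) (𝓝[>] (0 : ℝ)) (𝓝 z)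

/-- The unbounded operator `A` is the infinitesimal generator of the `C₀`-semigroup `S`:
`z ∈ D(A)` and `A z = w` if and only if `(S h z - z) / h → w` as `h → 0⁺`. -/
structure Generates (A : Y →ₗ.[ℝ] Y) (S : ℝ → Y →L[ℝ] Y) : Prop where
  semigroup : IsC0Semigroup S
  generator : ∀ z w : Y, (z, w) ∈ A.graph ↔
    Tendsto (fun h : ℝ => h⁻¹ • (S h z - z)) (𝓝[>] (0 : ℝ)) (𝓝 w)

/-- `Φ` (only its values at `0 ≤ s ≤ t` matter) is the evolution system generated by
`A + F(·)`, where `A` generates a `C₀`-semigroup and `F` is a family of bounded operators. -/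
def IsEvolutionSystem (A : Y →ₗ.[ℝ] Y) (F : ℝ → Y →L[ℝ] Y) (Φ : ℝ → ℝ → Y →L[ℝ] Y) : Prop :=
  ∃ S : ℝ → Y →L[ℝ] Y, Generates A S ∧
    (∀ s : ℝ, 0 ≤ s → Φ s s = ContinuousLinearMap.id ℝ Y) ∧
    (∀ t r s : ℝ, 0 ≤ s → s ≤ r → r ≤ t → Φ t s = (Φ t r).comp (Φ r s)) ∧
    (∀ z : Y, ContinuousOn (fun p : ℝ × ℝ => Φ p.1 p.2 z) {p : ℝ × ℝ | 0 ≤ p.2 ∧ p.2 ≤ p.1}) ∧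
    (∀ t s : ℝ, 0 ≤ s → s ≤ t → ∀ z : Y,
      Φ t s z = S (t - s) z + ∫ r in s..t, S (t - r) (F r (Φ r s z)))

/-- The system `y' = (A + F(t)) y`, `t ≥ 0`, is (exponentially) stable. -/
def IsStable (A : Y →ₗ.[ℝ] Y) (F : ℝ → Y →L[ℝ] Y) : Prop :=
  ∃ Φ : ℝ → ℝ → Y →L[ℝ] Y, IsEvolutionSystem A F Φ ∧
    ∃ M : ℝ, 0 < M ∧ ∃ γ : ℝ, 0 < γ ∧
      ∀ t s : ℝ, 0 ≤ s → s ≤ t → ∀ z : Y, ‖Φ t s z‖ ≤ M * Real.exp (-γ * (t - s)) * ‖z‖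

/-- The data of the control system `y'(t) = (A + D(t)) y(t) + B(t) u(t)`, `t ≥ 0`, with state space
`Y`, control space `U` and period `T`. -/
structure ControlSystem (Y U : Type*)
    [NormedAddCommGroup Y] [InnerProductSpace ℝ Y]
    [NormedAddCommGroup U] [InnerProductSpace ℝ U] where
  T : ℝ
  A : Y →ₗ.[ℝ] Y
  D : ℝ → Y →L[ℝ] Y
  B : ℝ → U →L[ℝ] Y

namespace ControlSystem

/-- The standing hypotheses on a linear time-periodic control system. -/
structure IsPeriodic (P : ControlSystem Y U) : Prop where
  T_pos : 0 < P.T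
  generates : ∃ S : ℝ → Y →L[ℝ] Y, Generates P.A S
  D_locallyIntegrable : LocallyIntegrableOn P.D (Ici 0)
  D_periodic : ∀ᵐ t ∂(volume.restrict (Ioi (0 : ℝ))), P.D (t + P.T) = P.D t
  B_bounded : MemLp P.B ⊤ (volume.restrict (Ioi (0 : ℝ)))
  B_periodic : ∀ᵐ t ∂(volume.restrict (Ioi (0 : ℝ))), P.B (t + P.T) = P.B t

/-- `Φ` is the evolution system of the uncontrolled system `y' = (A + D(t)) y`. -/
def IsEvolution (P : ControlSystem Y U) (Φ : ℝ → ℝ → Y →L[ℝ] Y) : Prop :=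
  IsEvolutionSystem P.A P.D Φ

/-- The solution `y(t; s, z, u)` at time `t` of the controlled equation with initial condition
`y(s) = z` (`Φ` being the evolution system of the uncontrolled system). -/
def solution (P : ControlSystem Y U) (Φ : ℝ → ℝ → Y →L[ℝ] Y) (t s : ℝ) (z : Y) (u : ℝ → U) : Y :=
  Φ t s z + ∫ r in s..t, Φ t r (P.B r (u r))

/-- Null controllability: every initial state can be steered to `0` in some time by an `L²` control.
The time may depend on the initial state; this is the weakest usual form of null controllability,
so that its negation excludes null controllability in any prescribed time as well. -/
def IsNullControllable (P : ControlSystem Y U) : Prop :=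
  ∃ Φ : ℝ → ℝ → Y →L[ℝ] Y, P.IsEvolution Φ ∧
    ∀ z : Y, ∃ τ : ℝ, 0 < τ ∧ ∃ u : ℝ → U,
      MemLp u 2 (volume.restrict (Ioi (0 : ℝ))) ∧ P.solution Φ τ 0 z u = 0

/-- `φ` is the (mild) solution on `[0, nT]` of the adjoint equation `φ' = -(A + D(t))^* φ`
with terminal condition `φ(nT) = ψ`; note that `A^*` generates the semigroup `S(·)^*`. -/
def IsAdjointSolution (P : ControlSystem Y U) (n : ℕ) (ψ : Y) (φ : ℝ → Y) : Prop :=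
  ∃ S : ℝ → Y →L[ℝ] Y, Generates P.A S ∧
    ContinuousOn φ (Icc 0 (n * P.T)) ∧
    ∀ t ∈ Icc 0 (n * P.T),
      φ t = (S (n * P.T - t)).adjoint ψ
        + ∫ r in t..(n * P.T), (S (r - t)).adjoint ((P.D r).adjoint (φ r))

/-- The detectability inequality with parameters `δ`, `n`, `C`:
`‖φ_n(0; ψ)‖ ≤ δ ‖ψ‖ + C ‖B(·)^* φ_n(·; ψ)‖_{L²(0, nT; U)}` for all `ψ ∈ Y`. -/
def DetectabilityInequality (P : ControlSystem Y U) (δ : ℝ) (n : ℕ) (C : ℝ) : Prop :=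
  ∀ (ψ : Y) (φ : ℝ → Y), P.IsAdjointSolution n ψ φ →
    ‖φ 0‖ ≤ δ * ‖ψ‖
      + C * Real.sqrt (∫ t in (0 : ℝ)..(n * P.T), ‖(P.B t).adjoint (φ t)‖ ^ 2)

/-- Periodic (exponential) stabilizability by a bounded `T`-periodic linear feedback. -/
def IsPeriodicallyStabilizable (P : ControlSystem Y U) : Prop :=
  ∃ K : ℝ → Y →L[ℝ] U,
    MemLp K ⊤ (volume.restrict (Ioi (0 : ℝ))) ∧
    (∀ᵐ t ∂(volume.restrict (Ioi (0 : ℝ))), K (P.T + t) = K t) ∧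
    IsStable P.A (fun t => P.D t + (P.B t).comp (K t))

end ControlSystem

end Abstract

/-! ### The Dirichlet Laplacian on `(0, π)` -/

/-- Lebesgue measure on the interval `(0, π)`. -/
abbrev μI : Measure ℝ := volume.restrict (Ioo 0 Real.pi)

/-- The real Hilbert space `L²(0, π)`. -/
abbrev L2I : Type := Lp ℝ 2 μI

/-- Smooth functions with compact support contained in `(0, π)`. -/
structure IsTest (φ : ℝ → ℝ) : Prop where
  smooth : ContDiff ℝ ∞ φ
  compact : HasCompactSupport φ
  support : tsupport φ ⊆ Ioo 0 Real.pi

/-- `g` is the weak derivative of `f` on `(0, π)`. -/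
def HasWeakDeriv (f g : L2I) : Prop :=
  ∀ φ : ℝ → ℝ, IsTest φ → ∫ x, f x * deriv φ x ∂μI = -∫ x, g x * φ x ∂μI

theorem isTest_zero : IsTest (fun _ => (0 : ℝ)) := by
  refine ⟨contDiff_const, HasCompactSupport.zero, ?_⟩
  have h : tsupport (fun _ : ℝ => (0 : ℝ)) = ∅ := tsupport_eq_empty_iff.2 rfl
  rw [h]
  exact empty_subset _

theorem IsTest.add {φ χ : ℝ → ℝ} (hφ : IsTest φ) (hχ : IsTest χ) :
    IsTest (fun x => φ x + χ x) :=
  ⟨hφ.smooth.add hχ.smooth, HasCompactSupport.add hφ.compact hχ.compact,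
    (tsupport_add φ χ).trans (union_subset hφ.support hχ.support)⟩

theorem IsTest.smul (c : ℝ) {φ : ℝ → ℝ} (hφ : IsTest φ) : IsTest (fun x => c * φ x) :=
  ⟨contDiff_const.mul hφ.smooth, HasCompactSupport.mul_left hφ.compact,
    (tsupport_mul_subset_right (f := fun _ => c)).trans hφ.support⟩

theorem IsTest.differentiable {φ : ℝ → ℝ} (hφ : IsTest φ) : Differentiable ℝ φ :=
  hφ.smooth.differentiable (by simp)

theorem integrable_mul_of_compact (f : L2I) {χ : ℝ → ℝ} (hχ : Continuous χ)
    (hc : HasCompactSupport χ) : Integrable (fun x => f x * χ x) μI := by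
  have h1 : MemLp χ 2 μI := (hχ.memLp_of_hasCompactSupport hc : MemLp χ 2 volume).restrict _
  exact (Lp.memLp f).integrable_mul h1

theorem IsTest.integrable_mul (f : L2I) {φ : ℝ → ℝ} (hφ : IsTest φ) :
    Integrable (fun x => f x * φ x) μI :=
  integrable_mul_of_compact f hφ.smooth.continuous hφ.compact

theorem IsTest.integrable_mul_deriv (f : L2I) {φ : ℝ → ℝ} (hφ : IsTest φ) :
    Integrable (fun x => f x * deriv φ x) μI :=
  integrable_mul_of_compact f (hφ.smooth.continuous_deriv (by simp)) hφ.compact.deriv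

theorem integral_coe_zero_mul (χ : ℝ → ℝ) : ∫ x, (0 : L2I) x * χ x ∂μI = 0 := by
  have h : (fun x => (0 : L2I) x * χ x) =ᵐ[μI] fun _ => 0 := by
    filter_upwards [Lp.coeFn_zero ℝ 2 μI] with x hx
    rw [hx, Pi.zero_apply, zero_mul]
  rw [integral_congr_ae h, integral_zero]

theorem HasWeakDeriv.zero : HasWeakDeriv 0 0 := by
  intro φ _
  rw [integral_coe_zero_mul, integral_coe_zero_mul, neg_zero]

theorem integral_coe_add_mul (f g : L2I) {χ : ℝ → ℝ}
    (hf : Integrable (fun x => f x * χ x) μI) (hg : Integrable (fun x => g x * χ x) μI) :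
    ∫ x, (f + g : L2I) x * χ x ∂μI = ∫ x, f x * χ x ∂μI + ∫ x, g x * χ x ∂μI := by
  rw [← integral_add hf hg]
  refine integral_congr_ae ?_
  filter_upwards [Lp.coeFn_add f g] with x hx
  rw [hx, Pi.add_apply, add_mul]

theorem integral_coe_smul_mul (c : ℝ) (f : L2I) (χ : ℝ → ℝ) :
    ∫ x, (c • f : L2I) x * χ x ∂μI = c * ∫ x, f x * χ x ∂μI := by
  rw [← integral_const_mul]
  refine integral_congr_ae ?_
  filter_upwards [Lp.coeFn_smul c f] with x hx
  simp [hx, mul_assoc]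

theorem HasWeakDeriv.add {f g f' g' : L2I} (h : HasWeakDeriv f g) (h' : HasWeakDeriv f' g') :
    HasWeakDeriv (f + f') (g + g') := by
  intro φ hφ
  rw [integral_coe_add_mul _ _ (hφ.integrable_mul_deriv f) (hφ.integrable_mul_deriv f'),
    integral_coe_add_mul _ _ (hφ.integrable_mul g) (hφ.integrable_mul g'), h φ hφ, h' φ hφ]
  ring

theorem HasWeakDeriv.smul (c : ℝ) {f g : L2I} (h : HasWeakDeriv f g) :
    HasWeakDeriv (c • f) (c • g) := by
  intro φ hφ
  rw [integral_coe_smul_mul, integral_coe_smul_mul, h φ hφ]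
  ring

theorem HasWeakDeriv.eq_zero {g : L2I} (h : HasWeakDeriv 0 g) : g = 0 := by
  have hloc : LocallyIntegrableOn (fun x => g x) (Ioo 0 Real.pi) volume := by
    have hi : Integrable (fun x => g x) μI := (Lp.memLp g).integrable (by norm_num)
    exact IntegrableOn.locallyIntegrableOn hi
  have key := isOpen_Ioo.ae_eq_zero_of_integral_contDiff_smul_eq_zero hloc (by
    intro φ h1 h2 h3
    have hφ := h φ ⟨h1, h2, h3⟩
    rw [integral_coe_zero_mul] at hφ
    rw [← setIntegral_eq_integral_of_forall_compl_eq_zero (s := Ioo 0 Real.pi)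
      (fun x hx => by
        have : φ x = 0 := by
          by_contra hne
          exact hx (h3 (subset_tsupport φ hne))
        simp [this])]
    have : ∫ x in Ioo 0 Real.pi, φ x • g x = ∫ x, g x * φ x ∂μI :=
      integral_congr_ae (by filter_upwards with x; simp [mul_comm])
    rw [this]
    linarith)
  apply Lp.ext
  have h2 : ∀ᵐ x ∂μI, g x = 0 := (ae_restrict_iff' measurableSet_Ioo).2 key
  filter_upwards [h2, Lp.coeFn_zero ℝ 2 μI] with x hx hx0
  rw [hx, hx0, Pi.zero_apply]

/-- All pairs `(φ, φ')` in `L² × L²`, with `φ` a test function. -/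
def testPairs : Submodule ℝ (L2I × L2I) where
  carrier := {p | ∃ φ : ℝ → ℝ, IsTest φ ∧ p.1 =ᵐ[μI] φ ∧ p.2 =ᵐ[μI] deriv φ}
  zero_mem' := by
    refine ⟨fun _ => 0, isTest_zero, Lp.coeFn_zero ℝ 2 μI, ?_⟩
    rw [deriv_const']
    exact Lp.coeFn_zero ℝ 2 μI
  add_mem' := by
    rintro ⟨a, b⟩ ⟨a', b'⟩ ⟨φ, hφ, h1, h2⟩ ⟨χ, hχ, h3, h4⟩
    refine ⟨_, hφ.add hχ, ?_, ?_⟩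
    · filter_upwards [Lp.coeFn_add a a', h1, h3] with x hx e1 e3
      simpa [e1, e3] using hx
    · filter_upwards [Lp.coeFn_add b b', h2, h4] with x hx e2 e4
      rw [deriv_fun_add (hφ.differentiable x) (hχ.differentiable x), ← e2, ← e4]
      simpa using hx
  smul_mem' := by
    rintro c ⟨a, b⟩ ⟨φ, hφ, h1, h2⟩
    refine ⟨_, hφ.smul c, ?_, ?_⟩
    · filter_upwards [Lp.coeFn_smul c a, h1] with x hx e1
      simpa [e1] using hx
    · filter_upwards [Lp.coeFn_smul c b, h2] with x hx e2
      rw [deriv_const_mul_field, ← e2]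
      simpa using hx

/-- `H¹₀(0, π)`: the closure of the test functions in the `H¹`-norm. -/
def H10 : Submodule ℝ L2I := testPairs.topologicalClosure.map (LinearMap.fst ℝ L2I L2I)

/-- The graph of the Dirichlet Laplacian: all `(f, f'')` with `f ∈ H²(0, π) ∩ H¹₀(0, π)`. -/
def laplacianGraph : Submodule ℝ (L2I × L2I) where
  carrier := {p | p.1 ∈ H10 ∧ ∃ g : L2I, HasWeakDeriv p.1 g ∧ HasWeakDeriv g p.2}
  zero_mem' := ⟨H10.zero_mem, 0, HasWeakDeriv.zero, HasWeakDeriv.zero⟩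
  add_mem' := by
    rintro p q ⟨hp, g, h1, h2⟩ ⟨hq, g', h3, h4⟩
    exact ⟨H10.add_mem hp hq, g + g', h1.add h3, h2.add h4⟩
  smul_mem' := by
    rintro c p ⟨hp, g, h1, h2⟩
    exact ⟨H10.smul_mem c hp, c • g, h1.smul c, h2.smul c⟩

theorem laplacianGraph_functional (p : L2I × L2I) (hp : p ∈ laplacianGraph) (h : p.1 = 0) :
    p.2 = 0 := by
  obtain ⟨-, g, h1, h2⟩ := hp
  rw [h] at h1
  rw [h1.eq_zero] at h2
  exact h2.eq_zero

/-- The Dirichlet Laplacian on `L²(0, π)`, with domain `H²(0, π) ∩ H¹₀(0, π)`. -/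
def dirichletLaplacian : L2I →ₗ.[ℝ] L2I := laplacianGraph.toLinearPMap

theorem dirichletLaplacian_graph : dirichletLaplacian.graph = laplacianGraph :=
  Submodule.toLinearPMap_graph_eq _ laplacianGraph_functional

theorem memLp_sin : MemLp Real.sin 2 μI :=
  MemLp.of_bound Real.continuous_sin.aestronglyMeasurable 1
    (by filter_upwards with x; simpa using Real.abs_sin_le_one x)

/-- The function `x ↦ sin x` as an element of `L²(0, π)`. -/
def sinL2 : L2I := memLp_sin.toLp Real.sin

/-- The controlled heat equation `y_t - (Δ + 3 sin² t) y = u(t) sin x` on `(0, π)` with homogeneous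
Dirichlet boundary conditions, with scalar control and period `T = π`. -/
def heatSystem : ControlSystem L2I ℝ where
  T := Real.pi
  A := dirichletLaplacian
  D := fun t => (3 * Real.sin t ^ 2) • ContinuousLinearMap.id ℝ L2I
  B := fun _ => ContinuousLinearMap.toSpanSingleton ℝ sinL2

end PeriodicStab

end

noncomputable section

namespace PeriodicStab

/-! ### Diagonal operators with respect to a Hilbert basis -/

section Diagonal

variable {Y : Type*} [NormedAddCommGroup Y] [InnerProductSpace ℝ Y]

/-! Everything is diagonal in the normalized sines. The Dirichlet Laplacian has eigenvalues
`-(k+1)²`, the potential `3 sin² t` is a scalar, and `B` only reaches the mode `k = 0`. Hence the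
modes decouple, and the free evolution multiplies mode `k` by `exp (prim t - prim s - (k+1)²
(t-s))`, where `prim` is a primitive of the potential and stays within `3/4` of `3t/2`.

All claims are read off from these exponents. Mode 0 grows at rate `3/2 - 1 = 1/2`, which gives
instability. Mode 1 is never touched by the control and never vanishes, which excludes null
controllability. Over one period the modes `k ≥ 1` shrink by at least `exp (-5π/2)`, while mode 0 is
exactly what `B^*` observes, which gives detectability. The feedback that subtracts the projection
onto mode 0 lowers the exponent of that mode to `3/2 - 2 = -1/2`, while the others are already at
most `3/2 - 4`. This feedback is constant in time and is exhibited directly, not deduced from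
detectability.

Two points carry the analytic weight. First, the Laplacian defined through weak derivatives and the
closure of the test functions must be shown to be this diagonal operator (`mem_laplacianGraph_iff`).
This uses completeness of the sines (`eq_zero_of_inner_sinVec_eq_zero`), their membership in `H¹₀`
(`sinVec_mem_closure`), and closedness of the weak derivative. Second, evolution systems and adjoint
solutions are specified through some semigroup generated by `A` and an integral equation, so
statements about all of them need uniqueness: of the semigroup (`Generates.eq_diagonalSemigroup`)
and of each scalar Volterra equation (`eq_mul_exp_of_volterra`). -/

theorem hilbertBasis_ext (b : HilbertBasis ℕ ℝ Y) {z w : Y}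
    (h : ∀ k, ⟪b k, z⟫_ℝ = ⟪b k, w⟫_ℝ) : z = w := by
  apply b.repr.injective
  ext k
  rw [b.repr_apply_apply, b.repr_apply_apply, h]

theorem hilbertBasis_hasSum_sq (b : HilbertBasis ℕ ℝ Y) (z : Y) :
    HasSum (fun k => ⟪b k, z⟫_ℝ ^ 2) (‖z‖ ^ 2) := by
  have h := b.hasSum_inner_mul_inner z z
  rw [real_inner_self_eq_norm_sq] at h
  refine h.congr_fun fun k => ?_
  rw [real_inner_comm, sq]

theorem hilbertBasis_inner_self (b : HilbertBasis ℕ ℝ Y) (j k : ℕ) :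
    ⟪b j, b k⟫_ℝ = if j = k then 1 else 0 :=
  orthonormal_iff_ite.1 b.orthonormal j k

/-- A bounded multiplier preserves square summability, so the new coefficients can be pulled back
through `b.repr`. The same termwise comparison, summed by Parseval, bounds the operator by `C`. -/
theorem exists_diagonal (b : HilbertBasis ℕ ℝ Y) {m : ℕ → ℝ} {C : ℝ} (hm : ∀ k, |m k| ≤ C) :
    ∃ L : Y →L[ℝ] Y, ∀ z k, ⟪b k, L z⟫_ℝ = m k * ⟪b k, z⟫_ℝ := by
  have hsq : ∀ k (x : ℝ), (m k * x) ^ 2 ≤ C ^ 2 * x ^ 2 := fun k x => by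
    rw [mul_pow, ← sq_abs (m k)]
    have := hm k
    gcongr
  have hsum : ∀ z : Y, Summable fun k => (m k * ⟪b k, z⟫_ℝ) ^ 2 := fun z =>
    Summable.of_nonneg_of_le (fun _ => sq_nonneg _) (fun k => hsq k _)
      ((hilbertBasis_hasSum_sq b z).summable.mul_left _)
  have hmem : ∀ z : Y, Memℓp (fun k => m k * ⟪b k, z⟫_ℝ) 2 := fun z => by
    rw [memℓp_gen_iff (by norm_num)]
    simpa [← abs_mul] using hsum z
  let f : Y →ₗ[ℝ] Y :=
    { toFun := fun z => b.repr.symm ⟨_, hmem z⟩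
      map_add' := fun z w => by
        rw [← map_add]
        congr 1
        ext k
        simp only [inner_add_right, mul_add]
        rfl
      map_smul' := fun c z => by
        rw [RingHom.id_apply, ← map_smul]
        congr 1
        ext k
        simp [inner_smul_right]
        ring }
  have hf : ∀ z k, ⟪b k, f z⟫_ℝ = m k * ⟪b k, z⟫_ℝ := fun z k => by
    rw [← b.repr_apply_apply]
    simp [f]
  refine ⟨f.mkContinuous C fun z => ?_, hf⟩
  have hC : 0 ≤ C := (abs_nonneg _).trans (hm 0)
  refine le_of_sq_le_sq ?_ (by positivity)
  rw [mul_pow]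
  refine hasSum_le (fun k => ?_) (hilbertBasis_hasSum_sq b (f z))
    ((hilbertBasis_hasSum_sq b z).mul_left (C ^ 2))
  rw [hf]
  exact hsq k _

open Classical in
/-- The diagonal operator with bounded eigenvalues `m k` with respect to the Hilbert basis `b`
(and `0` if `m` is unbounded). -/
def diagonal (b : HilbertBasis ℕ ℝ Y) (m : ℕ → ℝ) : Y →L[ℝ] Y :=
  if h : ∃ C, ∀ k, |m k| ≤ C then (exists_diagonal b h.choose_spec).choose else 0

theorem inner_diagonal (b : HilbertBasis ℕ ℝ Y) {m : ℕ → ℝ} {C : ℝ} (hm : ∀ k, |m k| ≤ C)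
    (k : ℕ) (z : Y) : ⟪b k, diagonal b m z⟫_ℝ = m k * ⟪b k, z⟫_ℝ := by
  have h : ∃ C, ∀ k, |m k| ≤ C := ⟨C, hm⟩
  rw [diagonal, dif_pos h]
  exact (exists_diagonal b h.choose_spec).choose_spec z k

/-- A vector all of whose coefficients are dominated by those of `z` up to a factor `C`. -/
theorem norm_le_of_abs_inner_le (b : HilbertBasis ℕ ℝ Y) {w z : Y} {C : ℝ} (hC : 0 ≤ C)
    (h : ∀ k, |⟪b k, w⟫_ℝ| ≤ C * |⟪b k, z⟫_ℝ|) : ‖w‖ ≤ C * ‖z‖ := by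
  refine le_of_sq_le_sq ?_ (by positivity)
  rw [mul_pow]
  refine hasSum_le (fun k => ?_) (hilbertBasis_hasSum_sq b w)
    ((hilbertBasis_hasSum_sq b z).mul_left (C ^ 2))
  rw [← sq_abs, ← sq_abs ⟪b k, z⟫_ℝ, ← mul_pow]
  gcongr
  exact h k

/-- Coefficientwise convergence, with coefficients dominated by those of a fixed vector, implies
convergence in norm. -/
theorem tendsto_of_inner_tendsto (b : HilbertBasis ℕ ℝ Y) {α : Type*} {l : Filter α}
    {f : α → Y} {w z : Y} (hf : ∀ᶠ a in l, ∀ k, |⟪b k, f a⟫_ℝ| ≤ |⟪b k, z⟫_ℝ|)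
    (hw : ∀ k, |⟪b k, w⟫_ℝ| ≤ |⟪b k, z⟫_ℝ|)
    (h : ∀ k, Tendsto (fun a => ⟪b k, f a⟫_ℝ) l (𝓝 ⟪b k, w⟫_ℝ)) : Tendsto f l (𝓝 w) := by
  rw [tendsto_iff_norm_sub_tendsto_zero]
  have hsq : Tendsto (fun a => ‖f a - w‖ ^ 2) l (𝓝 0) := by
    have key := tendsto_tsum_of_dominated_convergence (𝓕 := l)
      (f := fun a k => ⟪b k, f a - w⟫_ℝ ^ 2) (g := fun _ => (0 : ℝ))
      (bound := fun k => 4 * ⟪b k, z⟫_ℝ ^ 2)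
      ((hilbertBasis_hasSum_sq b z).summable.mul_left 4) (fun k => ?_) ?_
    · simpa only [(hilbertBasis_hasSum_sq b _).tsum_eq, tsum_zero] using key
    · have := ((h k).sub_const ⟪b k, w⟫_ℝ).pow 2
      simpa [inner_sub_right] using this
    · filter_upwards [hf] with a ha k
      rw [Real.norm_eq_abs, abs_of_nonneg (sq_nonneg _), inner_sub_right, ← sq_abs,
        ← sq_abs ⟪b k, z⟫_ℝ]
      have h1 := abs_sub ⟪b k, f a⟫_ℝ ⟪b k, w⟫_ℝ
      have h2 := ha k
      have h3 := hw k
      calc |⟪b k, f a⟫_ℝ - ⟪b k, w⟫_ℝ| ^ 2 ≤ (2 * |⟪b k, z⟫_ℝ|) ^ 2 := by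
            gcongr
            linarith
        _ = 4 * |⟪b k, z⟫_ℝ| ^ 2 := by ring
  have := hsq.sqrt
  simpa using this

theorem continuousLinearMap_ext_of_basis (b : HilbertBasis ℕ ℝ Y) {L M : Y →L[ℝ] Y}
    (h : ∀ k, L (b k) = M (b k)) : L = M := by
  refine ContinuousLinearMap.ext_on (s := range b) ?_ ?_
  · exact Submodule.dense_iff_topologicalClosure_eq_top.2 b.dense_span
  · rintro _ ⟨k, rfl⟩
    exact h k

/-! ### Diagonal semigroups -/

/-- The contraction semigroup with eigenvalues `exp (-μ k * t)`, extended by the identity to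
negative times. -/
def diagonalSemigroup (b : HilbertBasis ℕ ℝ Y) (μ : ℕ → ℝ) (t : ℝ) : Y →L[ℝ] Y :=
  diagonal b fun k => Real.exp (-μ k * max t 0)

variable {b : HilbertBasis ℕ ℝ Y} {μ : ℕ → ℝ}

theorem exp_neg_mul_max_le_one (hμ : ∀ k, 0 ≤ μ k) (t : ℝ) (k : ℕ) :
    |Real.exp (-μ k * max t 0)| ≤ 1 := by
  rw [Real.abs_exp, Real.exp_le_one_iff, neg_mul]
  have := mul_nonneg (hμ k) (le_max_right t 0)
  linarith

theorem inner_diagonalSemigroup (hμ : ∀ k, 0 ≤ μ k) (t : ℝ) (k : ℕ) (z : Y) :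
    ⟪b k, diagonalSemigroup b μ t z⟫_ℝ = Real.exp (-μ k * max t 0) * ⟪b k, z⟫_ℝ :=
  inner_diagonal b (exp_neg_mul_max_le_one hμ t) k z

theorem inner_diagonalSemigroup_of_nonneg (hμ : ∀ k, 0 ≤ μ k) {t : ℝ} (ht : 0 ≤ t) (k : ℕ)
    (z : Y) : ⟪b k, diagonalSemigroup b μ t z⟫_ℝ = Real.exp (-μ k * t) * ⟪b k, z⟫_ℝ := by
  rw [inner_diagonalSemigroup hμ, max_eq_left ht]

theorem diagonalSemigroup_apply_basis (hμ : ∀ k, 0 ≤ μ k) {t : ℝ} (ht : 0 ≤ t) (k : ℕ) :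
    diagonalSemigroup b μ t (b k) = Real.exp (-μ k * t) • b k := by
  refine hilbertBasis_ext b fun j => ?_
  rw [inner_diagonalSemigroup_of_nonneg hμ ht, inner_smul_right, hilbertBasis_inner_self]
  split_ifs with h
  · rw [h]
  · simp

theorem norm_diagonalSemigroup_apply_le (hμ : ∀ k, 0 ≤ μ k) (t : ℝ) (z : Y) :
    ‖diagonalSemigroup b μ t z‖ ≤ ‖z‖ := by
  rw [← one_mul ‖z‖]
  refine norm_le_of_abs_inner_le b zero_le_one fun k => ?_
  rw [inner_diagonalSemigroup hμ, abs_mul]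
  gcongr
  exact exp_neg_mul_max_le_one hμ t k

theorem diagonalSemigroup_zero (hμ : ∀ k, 0 ≤ μ k) :
    diagonalSemigroup b μ 0 = ContinuousLinearMap.id ℝ Y := by
  ext z
  refine hilbertBasis_ext b fun j => ?_
  rw [inner_diagonalSemigroup_of_nonneg hμ le_rfl]
  simp

theorem diagonalSemigroup_add (hμ : ∀ k, 0 ≤ μ k) {s t : ℝ} (hs : 0 ≤ s) (ht : 0 ≤ t) :
    diagonalSemigroup b μ (s + t) =
      (diagonalSemigroup b μ s).comp (diagonalSemigroup b μ t) := by
  ext z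
  refine hilbertBasis_ext b fun j => ?_
  rw [ContinuousLinearMap.comp_apply, inner_diagonalSemigroup_of_nonneg hμ (add_nonneg hs ht),
    inner_diagonalSemigroup_of_nonneg hμ hs, inner_diagonalSemigroup_of_nonneg hμ ht, ← mul_assoc,
    ← Real.exp_add, mul_add]

theorem continuous_diagonalSemigroup_apply (hμ : ∀ k, 0 ≤ μ k) (z : Y) :
    Continuous fun t => diagonalSemigroup b μ t z := by
  have hb : ∀ t k, |⟪b k, diagonalSemigroup b μ t z⟫_ℝ| ≤ |⟪b k, z⟫_ℝ| := fun t k => by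
    rw [inner_diagonalSemigroup hμ, abs_mul]
    exact mul_le_of_le_one_left (abs_nonneg _) (exp_neg_mul_max_le_one hμ t k)
  refine continuous_iff_continuousAt.2 fun t =>
    tendsto_of_inner_tendsto b (z := z) (Eventually.of_forall hb) (hb t) fun k => ?_
  simp only [inner_diagonalSemigroup hμ]
  exact Continuous.tendsto (by fun_prop) t

/-- Strong continuity upgrades to joint continuity because the operators are contractions: the error
from moving the vector is at most its displacement, and the error from moving the time concerns a
fixed vector. -/
theorem continuousOn_diagonalSemigroup (hμ : ∀ k, 0 ≤ μ k) {X : Type*} [TopologicalSpace X]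
    {s : Set X} {τ : X → ℝ} {f : X → Y} (hτ : ContinuousOn τ s) (hf : ContinuousOn f s) :
    ContinuousOn (fun x => diagonalSemigroup b μ (τ x) (f x)) s := by
  intro x hx
  have h1 : Tendsto (fun y => diagonalSemigroup b μ (τ y) (f y - f x)) (𝓝[s] x) (𝓝 0) := by
    refine squeeze_zero_norm (fun y => norm_diagonalSemigroup_apply_le hμ _ _) ?_
    simpa using ((hf x hx).sub_const (f x)).norm
  have h2 : Tendsto (fun y => diagonalSemigroup b μ (τ y) (f x)) (𝓝[s] x)
      (𝓝 (diagonalSemigroup b μ (τ x) (f x))) :=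
    ((continuous_diagonalSemigroup_apply hμ (f x)).tendsto _).comp (hτ x hx)
  have h3 := h1.add h2
  rw [zero_add] at h3
  refine h3.congr fun y => ?_
  rw [map_sub, sub_add_cancel]

theorem adjoint_diagonalSemigroup [CompleteSpace Y] (hμ : ∀ k, 0 ≤ μ k) (t : ℝ) :
    (diagonalSemigroup b μ t).adjoint = diagonalSemigroup b μ t := by
  refine continuousLinearMap_ext_of_basis b fun k => hilbertBasis_ext b fun j => ?_
  rw [ContinuousLinearMap.adjoint_inner_right, real_inner_comm, inner_diagonalSemigroup hμ,
    inner_diagonalSemigroup hμ, hilbertBasis_inner_self, hilbertBasis_inner_self]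
  by_cases h : j = k
  · rw [h]
  · rw [if_neg h, if_neg (Ne.symm h), mul_zero, mul_zero]

theorem isC0Semigroup_diagonalSemigroup (hμ : ∀ k, 0 ≤ μ k) :
    IsC0Semigroup (diagonalSemigroup b μ) where
  zero := diagonalSemigroup_zero hμ
  add _ _ hs ht := diagonalSemigroup_add hμ hs ht
  tendsto_zero z := by
    have h := ((continuous_diagonalSemigroup_apply (b := b) hμ z).tendsto 0)
    rw [diagonalSemigroup_zero hμ] at h
    exact h.mono_left nhdsWithin_le_nhds

theorem tendsto_inv_mul_exp_sub_one (a : ℝ) :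
    Tendsto (fun h : ℝ => h⁻¹ * (Real.exp (a * h) - 1)) (𝓝[>] 0) (𝓝 a) := by
  have hd : HasDerivAt (fun h : ℝ => Real.exp (a * h)) a 0 := by
    simpa using ((hasDerivAt_id (0 : ℝ)).const_mul a).exp
  simpa using hd.tendsto_slope_zero_right

/-- Each coefficient of the difference quotient tends to `-μ k` times that of `z`, so a limit can
only be `w`. Conversely `1 - exp (-μ k * h) ≤ μ k * h` dominates the quotients by the coefficients
of `w` itself, which turns coefficientwise convergence into norm convergence. -/
theorem diagonalSemigroup_generator_iff (hμ : ∀ k, 0 ≤ μ k) (z w : Y) :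
    Tendsto (fun h : ℝ => h⁻¹ • (diagonalSemigroup b μ h z - z)) (𝓝[>] (0 : ℝ)) (𝓝 w) ↔
      ∀ k, ⟪b k, w⟫_ℝ = -μ k * ⟪b k, z⟫_ℝ := by
  have hc : ∀ k, ∀ h : ℝ, 0 < h → ⟪b k, h⁻¹ • (diagonalSemigroup b μ h z - z)⟫_ℝ =
      h⁻¹ * (Real.exp (-μ k * h) - 1) * ⟪b k, z⟫_ℝ := fun k h hh => by
    rw [inner_smul_right, inner_sub_right, inner_diagonalSemigroup_of_nonneg hμ hh.le]
    ring
  have hlim : ∀ k, Tendsto (fun h : ℝ => ⟪b k, h⁻¹ • (diagonalSemigroup b μ h z - z)⟫_ℝ)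
      (𝓝[>] 0) (𝓝 (-μ k * ⟪b k, z⟫_ℝ)) := fun k => by
    refine ((tendsto_inv_mul_exp_sub_one (-μ k)).mul_const _).congr' ?_
    filter_upwards [self_mem_nhdsWithin] with h hh
    rw [hc k h hh]
  constructor
  · intro ht k
    exact tendsto_nhds_unique
      ((((innerSL ℝ (b k)).continuous.tendsto w).comp ht).congr fun h => rfl) (hlim k)
  · intro hw
    refine tendsto_of_inner_tendsto b (z := w) ?_ (fun _ => le_rfl) fun k => ?_
    · filter_upwards [self_mem_nhdsWithin] with h hh k
      have hh' : 0 < h := hh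
      rw [hc k h hh, hw, abs_mul, abs_mul (-μ k)]
      refine mul_le_mul_of_nonneg_right ?_ (abs_nonneg _)
      have h1 : Real.exp (-μ k * h) ≤ 1 := by
        rw [Real.exp_le_one_iff, neg_mul]
        have := mul_nonneg (hμ k) hh'.le
        linarith
      have h2 := Real.add_one_le_exp (-μ k * h)
      rw [abs_mul, abs_neg, abs_of_nonneg (hμ k), abs_of_pos (inv_pos.2 hh'),
        abs_of_nonpos (by linarith), inv_mul_le_iff₀ hh']
      linarith
    · rw [hw]
      exact hlim k

/-- A linear operator that is diagonal with respect to `b` generates the diagonal semigroup. -/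
theorem generates_diagonalSemigroup (hμ : ∀ k, 0 ≤ μ k) {A : Y →ₗ.[ℝ] Y}
    (hA : ∀ z w : Y, (z, w) ∈ A.graph ↔ ∀ k, ⟪b k, w⟫_ℝ = -μ k * ⟪b k, z⟫_ℝ) :
    Generates A (diagonalSemigroup b μ) where
  semigroup := isC0Semigroup_diagonalSemigroup hμ
  generator z w := (hA z w).trans (diagonalSemigroup_generator_iff hμ z w).symm

end Diagonal

/-! ### Uniqueness of the semigroup generated by a diagonal operator -/

section Uniqueness

variable {Y : Type*} [NormedAddCommGroup Y] [InnerProductSpace ℝ Y]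
  {b : HilbertBasis ℕ ℝ Y} {μ : ℕ → ℝ} {A : Y →ₗ.[ℝ] Y} {S : ℝ → Y →L[ℝ] Y}

/-- `S t` commutes with `S r`, hence with the difference quotients defining `A`. -/
theorem Generates.mem_graph_apply (hS : Generates A S) {t : ℝ} (ht : 0 ≤ t) {z w : Y}
    (h : (z, w) ∈ A.graph) : (S t z, S t w) ∈ A.graph := by
  rw [hS.generator] at h ⊢
  refine (((S t).continuous.tendsto w).comp h).congr' ?_
  filter_upwards [self_mem_nhdsWithin] with r hr
  have h1 := congrArg (fun L : Y →L[ℝ] Y => L z) (hS.semigroup.add t r ht (le_of_lt hr))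
  have h2 := congrArg (fun L : Y →L[ℝ] Y => L z) (hS.semigroup.add r t (le_of_lt hr) ht)
  simp only [ContinuousLinearMap.comp_apply] at h1 h2
  rw [add_comm] at h2
  simp only [Function.comp_apply, map_smul, map_sub]
  rw [← h1, h2]

theorem IsC0Semigroup.apply_nsmul_of_eigenvector (hS : IsC0Semigroup S) {e : Y} {c : ℝ → ℝ}
    (hc : ∀ t, 0 ≤ t → S t e = c t • e) {t : ℝ} (ht : 0 ≤ t) (n : ℕ) :
    S (n * t) e = c t ^ n • e := by
  induction n with
  | zero => simp [hS.zero]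
  | succ n ih =>
    rw [Nat.cast_succ, add_mul, one_mul, hS.add _ _ (by positivity) ht,
      ContinuousLinearMap.comp_apply, hc t ht, map_smul, ih, smul_smul, pow_succ, mul_comm]

/-- Since `S t` commutes with `A`, it maps `b k` into the eigenspace of `-μ k`, which is a line
because the eigenvalues are distinct. The resulting scalar `c` is multiplicative with right
derivative `-μ k` at `0`, so `c t = c (t / n) ^ n` tends to the exponential. No differential
equation for `c` at positive times is needed. -/
theorem Generates.apply_basis (hμ : Function.Injective μ)
    (hA : ∀ z w : Y, (z, w) ∈ A.graph ↔ ∀ k, ⟪b k, w⟫_ℝ = -μ k * ⟪b k, z⟫_ℝ)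
    (hS : Generates A S) (k : ℕ) {t : ℝ} (ht : 0 ≤ t) :
    S t (b k) = Real.exp (-μ k * t) • b k := by
  have hgr : (b k, -μ k • b k) ∈ A.graph := (hA _ _).2 fun j => by
    rw [inner_smul_right, hilbertBasis_inner_self]
    split_ifs with h
    · rw [h]
    · simp
  have hc : ∀ r, 0 ≤ r → S r (b k) = ⟪b k, S r (b k)⟫_ℝ • b k := fun r hr => by
    refine hilbertBasis_ext b fun j => ?_
    rw [inner_smul_right, hilbertBasis_inner_self]
    split_ifs with h
    · rw [h, mul_one]
    · have h1 := (hA _ _).1 (hS.mem_graph_apply hr hgr) j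
      rw [map_smul, inner_smul_right] at h1
      have h2 : (μ j - μ k) * ⟪b j, S r (b k)⟫_ℝ = 0 := by linarith
      rcases mul_eq_zero.1 h2 with h3 | h3
      · exact absurd (hμ (sub_eq_zero.1 h3)) h
      · rw [h3, mul_zero]
  rcases ht.eq_or_lt with rfl | ht
  · simp [hS.semigroup.zero]
  set c : ℝ → ℝ := fun r => ⟪b k, S r (b k)⟫_ℝ with hcdef
  have hlim : Tendsto (fun h : ℝ => h⁻¹ * (c h - 1)) (𝓝[>] 0) (𝓝 (-μ k)) := by
    have h1 := (hS.generator _ _).1 hgr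
    have h2 := ((innerSL ℝ (b k)).continuous.tendsto _).comp h1
    have hbk : ‖b k‖ = 1 := b.orthonormal.1 k
    simpa [Function.comp_def, inner_smul_right, inner_sub_right, hbk] using h2
  have hseq : Tendsto (fun n : ℕ => t / n) atTop (𝓝[>] 0) := by
    refine tendsto_nhdsWithin_iff.2 ⟨tendsto_const_div_atTop_nhds_zero_nat t, ?_⟩
    filter_upwards [eventually_gt_atTop 0] with n hn
    have : (0 : ℝ) < n := by exact_mod_cast hn
    exact div_pos ht this
  have hpow : Tendsto (fun n : ℕ => (1 + (c (t / n) - 1)) ^ n) atTop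
      (𝓝 (Real.exp (-μ k * t))) := by
    refine Real.tendsto_one_add_pow_exp_of_tendsto ?_
    refine ((hlim.comp hseq).mul_const t).congr' ?_
    filter_upwards [eventually_gt_atTop 0] with n hn
    have : (0 : ℝ) < n := by exact_mod_cast hn
    simp only [Function.comp_apply]
    field_simp
  have hconst : ∀ᶠ n : ℕ in atTop, (1 + (c (t / n) - 1)) ^ n = c t := by
    filter_upwards [eventually_gt_atTop 0] with n hn
    have hn' : (0 : ℝ) < n := by exact_mod_cast hn
    have h1 := hS.semigroup.apply_nsmul_of_eigenvector hc (div_nonneg ht.le hn'.le) n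
    rw [mul_div_cancel₀ _ hn'.ne'] at h1
    have h2 : c t = c (t / n) ^ n := by
      rw [hcdef]
      simp only
      rw [h1, inner_smul_right, hilbertBasis_inner_self, if_pos rfl, mul_one]
    rw [h2, add_sub_cancel]
  rw [hc t ht.le, tendsto_nhds_unique hpow
    (tendsto_const_nhds.congr' (hconst.mono fun _ h => h.symm))]

theorem Generates.eq_diagonalSemigroup (hinj : Function.Injective μ) (hμ : ∀ k, 0 ≤ μ k)
    (hA : ∀ z w : Y, (z, w) ∈ A.graph ↔ ∀ k, ⟪b k, w⟫_ℝ = -μ k * ⟪b k, z⟫_ℝ)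
    (hS : Generates A S) {t : ℝ} (ht : 0 ≤ t) : S t = diagonalSemigroup b μ t :=
  continuousLinearMap_ext_of_basis b fun k => by
    rw [hS.apply_basis hinj hA k ht, diagonalSemigroup_apply_basis hμ ht]

end Uniqueness

/-! ### Bounded continuous functions as elements of `L²(0, π)` -/

theorem memLp_of_continuous {f : ℝ → ℝ} (hf : Continuous f) : MemLp f 2 μI := by
  obtain ⟨C, hC⟩ := isCompact_Icc.exists_bound_of_continuousOn (s := Icc 0 Real.pi) hf.continuousOn
  refine MemLp.of_bound hf.aestronglyMeasurable C ?_
  rw [ae_restrict_iff' measurableSet_Ioo]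
  exact Eventually.of_forall fun x hx => hC x (Ioo_subset_Icc_self hx)

/-- The restriction to `(0, π)` of a continuous function on the line. -/
def contL2 {f : ℝ → ℝ} (hf : Continuous f) : L2I := (memLp_of_continuous hf).toLp f

theorem coeFn_contL2 {f : ℝ → ℝ} (hf : Continuous f) : contL2 hf =ᵐ[μI] f :=
  MemLp.coeFn_toLp _

theorem inner_contL2 (g : L2I) {f : ℝ → ℝ} (hf : Continuous f) :
    ⟪g, contL2 hf⟫_ℝ = ∫ x, g x * f x ∂μI := by
  rw [L2.inner_def]
  refine integral_congr_ae ?_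
  filter_upwards [coeFn_contL2 hf] with x hx
  rw [hx]
  exact mul_comm _ _

theorem integral_μI (f : ℝ → ℝ) : ∫ x, f x ∂μI = ∫ x in (0 : ℝ)..Real.pi, f x := by
  rw [intervalIntegral.integral_of_le Real.pi_pos.le, integral_Ioc_eq_integral_Ioo]

theorem inner_contL2_contL2 {f g : ℝ → ℝ} (hf : Continuous f) (hg : Continuous g) :
    ⟪contL2 hf, contL2 hg⟫_ℝ = ∫ x in (0 : ℝ)..Real.pi, f x * g x := by
  rw [inner_contL2, ← integral_μI]
  refine integral_congr_ae ?_
  filter_upwards [coeFn_contL2 hf] with x hx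
  rw [hx]

/-! ### Sines and cosines in `L²(0, π)` -/

theorem integral_cos_int_mul {m : ℤ} (hm : m ≠ 0) :
    ∫ x in (0 : ℝ)..Real.pi, Real.cos (m * x) = 0 := by
  have hm' : (m : ℝ) ≠ 0 := by exact_mod_cast hm
  rw [intervalIntegral.integral_comp_mul_left (fun x => Real.cos x) hm', integral_cos,
    Real.sin_int_mul_pi]
  simp

theorem integral_cos_mul_cos (m n : ℕ) :
    ∫ x in (0 : ℝ)..Real.pi, Real.cos ((m + 1) * x) * Real.cos ((n + 1) * x) =
      if m = n then Real.pi / 2 else 0 := by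
  have h : ∀ x : ℝ, Real.cos ((m + 1) * x) * Real.cos ((n + 1) * x) =
      (Real.cos ((m - n : ℤ) * x) + Real.cos ((m + n + 2 : ℤ) * x)) / 2 := fun x => by
    push_cast
    rw [show ((m : ℝ) - n) * x = (m + 1) * x - (n + 1) * x by ring,
      show ((m : ℝ) + n + 2) * x = (m + 1) * x + (n + 1) * x by ring, Real.cos_sub, Real.cos_add]
    ring
  simp_rw [h]
  rw [intervalIntegral.integral_div, intervalIntegral.integral_add
    (Continuous.intervalIntegrable (by fun_prop) _ _)
    (Continuous.intervalIntegrable (by fun_prop) _ _),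
    integral_cos_int_mul (m := m + n + 2) (by omega)]
  split_ifs with hmn
  · simp [hmn]
  · rw [integral_cos_int_mul (by omega)]
    simp

theorem integral_sin_mul_sin (m n : ℕ) :
    ∫ x in (0 : ℝ)..Real.pi, Real.sin ((m + 1) * x) * Real.sin ((n + 1) * x) =
      if m = n then Real.pi / 2 else 0 := by
  have h : ∀ x : ℝ, Real.sin ((m + 1) * x) * Real.sin ((n + 1) * x) =
      (Real.cos ((m - n : ℤ) * x) - Real.cos ((m + n + 2 : ℤ) * x)) / 2 := fun x => by
    push_cast
    rw [show ((m : ℝ) - n) * x = (m + 1) * x - (n + 1) * x by ring,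
      show ((m : ℝ) + n + 2) * x = (m + 1) * x + (n + 1) * x by ring, Real.cos_sub, Real.cos_add]
    ring
  simp_rw [h]
  rw [intervalIntegral.integral_div, intervalIntegral.integral_sub
    (Continuous.intervalIntegrable (by fun_prop) _ _)
    (Continuous.intervalIntegrable (by fun_prop) _ _),
    integral_cos_int_mul (m := m + n + 2) (by omega)]
  split_ifs with hmn
  · simp [hmn]
  · rw [integral_cos_int_mul (by omega)]
    simp

/-- The normalization constant of the sines and cosines. -/
def nrm : ℝ := Real.sqrt (2 / Real.pi)

theorem nrm_pos : 0 < nrm := Real.sqrt_pos.2 (by positivity)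

theorem nrm_sq : nrm * nrm = 2 / Real.pi := Real.mul_self_sqrt (by positivity)

/-- `√(2/π) sin ((k + 1) x)`. -/
def sinVec (k : ℕ) : L2I :=
  contL2 (f := fun x => nrm * Real.sin ((k + 1) * x)) (by fun_prop)

/-- `√(2/π) cos ((k + 1) x)`. -/
def cosVec (k : ℕ) : L2I :=
  contL2 (f := fun x => nrm * Real.cos ((k + 1) * x)) (by fun_prop)

theorem orthonormal_sinVec : Orthonormal ℝ sinVec := by
  rw [orthonormal_iff_ite]
  intro i j
  rw [sinVec, sinVec, inner_contL2_contL2]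
  simp_rw [mul_mul_mul_comm nrm]
  rw [intervalIntegral.integral_const_mul, integral_sin_mul_sin, nrm_sq]
  split_ifs
  · field_simp
  · simp

theorem orthonormal_cosVec : Orthonormal ℝ cosVec := by
  rw [orthonormal_iff_ite]
  intro i j
  rw [cosVec, cosVec, inner_contL2_contL2]
  simp_rw [mul_mul_mul_comm nrm]
  rw [intervalIntegral.integral_const_mul, integral_cos_mul_cos, nrm_sq]
  split_ifs
  · field_simp
  · simp

theorem sinL2_eq : sinL2 = nrm⁻¹ • sinVec 0 := by
  apply Lp.ext
  filter_upwards [Lp.coeFn_smul nrm⁻¹ (sinVec 0), coeFn_contL2 (f := fun x => nrm *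
    Real.sin (((0 : ℕ) + 1) * x)) (by fun_prop), MemLp.coeFn_toLp memLp_sin] with x h1 h2 h3
  rw [h1, sinL2, h3, Pi.smul_apply, sinVec, h2]
  simp [inv_mul_cancel_left₀ nrm_pos.ne']

theorem integrable_mul_continuous (f : L2I) {χ : ℝ → ℝ} (hχ : Continuous χ) :
    Integrable (fun x => f x * χ x) μI :=
  (Lp.memLp f).integrable_mul (memLp_of_continuous hχ)

/-- Zero and negative frequencies are included because the product formula used in the next
induction lowers the frequency. -/
theorem integral_mul_sin_int_eq_zero {f : L2I} (hf : ∀ k, ⟪sinVec k, f⟫_ℝ = 0)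
    (m : ℤ) : ∫ x, f x * Real.sin (m * x) ∂μI = 0 := by
  have hpos : ∀ k : ℕ, ∫ x, f x * Real.sin ((k + 1) * x) ∂μI = 0 := fun k => by
    have h := hf k
    rw [real_inner_comm, sinVec, inner_contL2] at h
    simp_rw [mul_left_comm _ nrm] at h
    rw [integral_const_mul] at h
    exact (mul_eq_zero.1 h).resolve_left nrm_pos.ne'
  rcases lt_trichotomy m 0 with h | h | h
  · obtain ⟨k, rfl⟩ : ∃ k : ℕ, m = -(k + 1) := ⟨(-m - 1).toNat, by omega⟩
    push_cast
    simp_rw [neg_mul, Real.sin_neg, mul_neg]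
    rw [integral_neg, hpos, neg_zero]
  · simp [h]
  · obtain ⟨k, rfl⟩ : ∃ k : ℕ, m = k + 1 := ⟨(m - 1).toNat, by omega⟩
    exact_mod_cast hpos k

/-- Induction on `j` through `2 sin(mx) cos x = sin((m+1)x) + sin((m-1)x)`. -/
theorem integral_mul_sin_mul_cos_pow_eq_zero {f : L2I} (hf : ∀ k, ⟪sinVec k, f⟫_ℝ = 0)
    (j : ℕ) (m : ℤ) :
    ∫ x, f x * (Real.sin (m * x) * Real.cos x ^ j) ∂μI = 0 := by
  induction j generalizing m with
  | zero => simpa using integral_mul_sin_int_eq_zero hf m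
  | succ j ih =>
    have h : ∀ x : ℝ, f x * (Real.sin (m * x) * Real.cos x ^ (j + 1)) =
        2⁻¹ * (f x * (Real.sin ((m + 1 : ℤ) * x) * Real.cos x ^ j) +
          f x * (Real.sin ((m - 1 : ℤ) * x) * Real.cos x ^ j)) := fun x => by
      push_cast
      rw [add_mul, sub_mul, one_mul, Real.sin_add, Real.sin_sub]
      ring
    simp_rw [h]
    rw [integral_const_mul, integral_add (integrable_mul_continuous f (by fun_prop))
      (integrable_mul_continuous f (by fun_prop)), ih, ih]
    simp

theorem integral_mul_sin_mul_eval_cos_eq_zero {f : L2I} (hf : ∀ k, ⟪sinVec k, f⟫_ℝ = 0)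
    (p : Polynomial ℝ) :
    ∫ x, f x * (Real.sin x * p.eval (Real.cos x)) ∂μI = 0 := by
  have h : ∀ x : ℝ, f x * (Real.sin x * p.eval (Real.cos x)) =
      ∑ j ∈ p.support, p.coeff j * (f x * (Real.sin ((1 : ℤ) * x) * Real.cos x ^ j)) := fun x => by
    rw [Polynomial.eval_eq_sum, Polynomial.sum, Finset.mul_sum, Finset.mul_sum]
    refine Finset.sum_congr rfl fun j _ => ?_
    push_cast
    rw [one_mul]
    ring
  simp_rw [h]
  rw [integral_finsetSum _ fun j _ =>
    (integrable_mul_continuous f (by fun_prop)).const_mul _]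
  refine Finset.sum_eq_zero fun j _ => ?_
  rw [integral_const_mul, integral_mul_sin_mul_cos_pow_eq_zero hf, mul_zero]

/-- On `(0, π)` every continuous function of `x` is a continuous function of `cos x`. Weierstrass
approximation of `φ ∘ arccos` on `[-1, 1]` therefore reduces the claim to polynomials in `cos x`. -/
theorem integral_mul_sin_mul_continuous_eq_zero {f : L2I} (hf : ∀ k, ⟪sinVec k, f⟫_ℝ = 0)
    {φ : ℝ → ℝ} (hφ : Continuous φ) :
    ∫ x, f x * (Real.sin x * φ x) ∂μI = 0 := by
  set I := ∫ x, |f x| ∂μI with hI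
  have hI0 : 0 ≤ I := integral_nonneg fun x => abs_nonneg _
  have hfi : Integrable (fun x => f x) μI := (Lp.memLp f).integrable (by norm_num)
  have hsmall : ∀ ε : ℝ, 0 < ε → |∫ x, f x * (Real.sin x * φ x) ∂μI| ≤ ε * I := by
    intro ε hε
    obtain ⟨p, hp⟩ := exists_polynomial_near_of_continuousOn (-1) 1 (fun y => φ (Real.arccos y))
      (hφ.comp Real.continuous_arccos).continuousOn ε hε
    have hsub : ∫ x, f x * (Real.sin x * φ x) ∂μI =
        ∫ x, f x * (Real.sin x * (φ x - p.eval (Real.cos x))) ∂μI := by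
      simp_rw [mul_sub]
      rw [integral_sub (integrable_mul_continuous f (by fun_prop))
        (integrable_mul_continuous f (by fun_prop)), integral_mul_sin_mul_eval_cos_eq_zero hf,
        sub_zero]
    rw [hsub, hI, ← integral_const_mul]
    refine (abs_integral_le_integral_abs).trans (integral_mono_ae
      (integrable_mul_continuous f (by fun_prop)).abs (hfi.abs.const_mul ε) ?_)
    rw [EventuallyLE, ae_restrict_iff' measurableSet_Ioo]
    refine Eventually.of_forall fun x hx => ?_
    have h1 := hp (Real.cos x) ⟨Real.neg_one_le_cos x, Real.cos_le_one x⟩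
    simp only [Real.arccos_cos hx.1.le hx.2.le] at h1
    rw [abs_sub_comm] at h1
    simp only [abs_mul]
    have h2 := Real.abs_sin_le_one x
    calc |f x| * (|Real.sin x| * |φ x - p.eval (Real.cos x)|) ≤ |f x| * (1 * ε) := by gcongr
      _ = ε * |f x| := by ring
  by_contra hne
  have hpos := abs_pos.2 hne
  -- This `ε` makes the bound `ε * I` less than half of the supposedly nonzero integral; the `+ 1`
  -- covers `I = 0`.
  have h := hsmall (|∫ x, f x * (Real.sin x * φ x) ∂μI| / (2 * (I + 1))) (by positivity)
  rw [div_mul_eq_mul_div, le_div_iff₀ (by positivity)] at h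
  nlinarith

/-- Completeness of the sines: `f * sin` integrates to zero against all test functions, so it
vanishes almost everywhere, and `sin` is positive on `(0, π)`. -/
theorem eq_zero_of_inner_sinVec_eq_zero {f : L2I} (hf : ∀ k, ⟪sinVec k, f⟫_ℝ = 0) :
    f = 0 := by
  have hloc : LocallyIntegrableOn (fun x => f x * Real.sin x) (Ioo 0 Real.pi) volume :=
    IntegrableOn.locallyIntegrableOn (integrable_mul_continuous f Real.continuous_sin)
  have key := isOpen_Ioo.ae_eq_zero_of_integral_contDiff_smul_eq_zero hloc (by
    intro φ h1 _ h3
    rw [← setIntegral_eq_integral_of_forall_compl_eq_zero (s := Ioo 0 Real.pi) fun x hx => by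
      rw [image_eq_zero_of_notMem_tsupport fun h => hx (h3 h), zero_smul]]
    refine Eq.trans ?_ (integral_mul_sin_mul_continuous_eq_zero hf h1.continuous)
    refine integral_congr_ae (Eventually.of_forall fun x => ?_)
    simp only [smul_eq_mul]
    ring)
  apply Lp.ext
  have h2 : ∀ᵐ x ∂μI, f x = 0 := by
    rw [ae_restrict_iff' measurableSet_Ioo]
    filter_upwards [key] with x hx hxm
    exact (mul_eq_zero.1 (hx hxm)).resolve_right (Real.sin_pos_of_mem_Ioo hxm).ne'
  filter_upwards [h2, Lp.coeFn_zero ℝ 2 μI] with x hx hx0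
  rw [hx, hx0, Pi.zero_apply]

/-- The Hilbert basis of `L²(0, π)` consisting of normalized sines. -/
def sinBasis : HilbertBasis ℕ ℝ L2I :=
  HilbertBasis.mkOfOrthogonalEqBot orthonormal_sinVec (by
    rw [Submodule.eq_bot_iff]
    intro f hf
    exact eq_zero_of_inner_sinVec_eq_zero fun k =>
      (Submodule.mem_orthogonal _ _).1 hf _ (Submodule.subset_span ⟨k, rfl⟩))

theorem sinBasis_apply (k : ℕ) : sinBasis k = sinVec k := by
  rw [sinBasis, HilbertBasis.coe_mkOfOrthogonalEqBot]

/-! ### Closedness of the weak derivative -/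

theorem IsTest.continuous {φ : ℝ → ℝ} (hφ : IsTest φ) : Continuous φ := hφ.smooth.continuous

theorem IsTest.continuous_deriv {φ : ℝ → ℝ} (hφ : IsTest φ) : Continuous (deriv φ) :=
  hφ.smooth.continuous_deriv (by simp)

theorem IsTest.eq_zero {φ : ℝ → ℝ} (hφ : IsTest φ) {x : ℝ} (hx : x ∉ Ioo 0 Real.pi) : φ x = 0 :=
  image_eq_zero_of_notMem_tsupport fun h => hx (hφ.support h)

theorem hasWeakDeriv_iff {f g : L2I} : HasWeakDeriv f g ↔ ∀ φ (hφ : IsTest φ),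
    ⟪f, contL2 hφ.continuous_deriv⟫_ℝ = -⟪g, contL2 hφ.continuous⟫_ℝ := by
  simp only [HasWeakDeriv, inner_contL2]

theorem isClosed_hasWeakDeriv : IsClosed {p : L2I × L2I | HasWeakDeriv p.1 p.2} := by
  simp only [hasWeakDeriv_iff, ofPred_forall]
  refine isClosed_iInter fun φ => isClosed_iInter fun hφ => isClosed_eq ?_ ?_
  · exact continuous_fst.inner continuous_const
  · exact (continuous_snd.inner continuous_const).neg

/-- The graph of the weak derivative. -/
def weakDerivGraph : Submodule ℝ (L2I × L2I) where
  carrier := {p | HasWeakDeriv p.1 p.2}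
  zero_mem' := HasWeakDeriv.zero
  add_mem' := fun hp hq => HasWeakDeriv.add hp hq
  smul_mem' := fun c _ hp => HasWeakDeriv.smul c hp

theorem HasWeakDeriv.unique {f g h : L2I} (hg : HasWeakDeriv f g) (hh : HasWeakDeriv f h) :
    g = h := by
  have h1 := hg.add (hh.smul (-1))
  rw [neg_one_smul, neg_one_smul, add_neg_cancel] at h1
  exact add_neg_eq_zero.1 h1.eq_zero

/-- Integration by parts against test functions. -/
theorem hasWeakDeriv_contL2 {u u' : ℝ → ℝ} (hu : ∀ x, HasDerivAt u (u' x) x) (hc : Continuous u)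
    (hc' : Continuous u') : HasWeakDeriv (contL2 hc) (contL2 hc') := by
  rw [hasWeakDeriv_iff]
  intro φ hφ
  rw [inner_contL2_contL2, inner_contL2_contL2,
    intervalIntegral.integral_mul_deriv_eq_deriv_mul (u := u) (u' := u') (v := φ)
      (fun x _ => hu x) (fun x _ => (hφ.differentiable x).hasDerivAt)
      (hc'.intervalIntegrable _ _) (hφ.continuous_deriv.intervalIntegrable _ _),
    hφ.eq_zero (x := Real.pi) (by simp), hφ.eq_zero (x := 0) (by simp)]
  simp

theorem mem_testPairs_of_isTest {φ : ℝ → ℝ} (hφ : IsTest φ) :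
    (contL2 hφ.continuous, contL2 hφ.continuous_deriv) ∈ testPairs :=
  ⟨φ, hφ, coeFn_contL2 hφ.continuous, coeFn_contL2 hφ.continuous_deriv⟩

theorem exists_isTest_of_mem_testPairs {p : L2I × L2I} (hp : p ∈ testPairs) :
    ∃ φ, ∃ hφ : IsTest φ, p = (contL2 hφ.continuous, contL2 hφ.continuous_deriv) := by
  obtain ⟨φ, hφ, h1, h2⟩ := hp
  exact ⟨φ, hφ, Prod.ext (Lp.ext (h1.trans (coeFn_contL2 hφ.continuous).symm))
    (Lp.ext (h2.trans (coeFn_contL2 hφ.continuous_deriv).symm))⟩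

theorem hasWeakDeriv_of_mem_closure {p : L2I × L2I} (hp : p ∈ testPairs.topologicalClosure) :
    HasWeakDeriv p.1 p.2 := by
  refine closure_minimal (t := {p : L2I × L2I | HasWeakDeriv p.1 p.2}) ?_ isClosed_hasWeakDeriv hp
  intro q hq
  obtain ⟨φ, hφ, rfl⟩ := exists_isTest_of_mem_testPairs hq
  exact hasWeakDeriv_contL2 (fun x => (hφ.differentiable x).hasDerivAt) hφ.continuous
    hφ.continuous_deriv

/-- Integration by parts of an `H¹` function against an `H¹₀` function. -/
theorem HasWeakDeriv.inner_of_mem_closure {f g : L2I} (h : HasWeakDeriv f g) {p : L2I × L2I}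
    (hp : p ∈ testPairs.topologicalClosure) : ⟪f, p.2⟫_ℝ = -⟪g, p.1⟫_ℝ := by
  refine closure_minimal (t := {p : L2I × L2I | ⟪f, p.2⟫_ℝ = -⟪g, p.1⟫_ℝ}) ?_ ?_ hp
  · intro q hq
    obtain ⟨φ, hφ, rfl⟩ := exists_isTest_of_mem_testPairs hq
    exact hasWeakDeriv_iff.1 h φ hφ
  · exact isClosed_eq (continuous_const.inner continuous_snd)
      (continuous_const.inner continuous_fst).neg

theorem Submodule.mem_of_hasSum {E : Type*} [NormedAddCommGroup E] [NormedSpace ℝ E]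
    {p : Submodule ℝ E} (hp : IsClosed (p : Set E)) {ι : Type*} {f : ι → E} {x : E}
    (hf : HasSum f x) (h : ∀ i, f i ∈ p) : x ∈ p :=
  hp.mem_of_tendsto hf (Eventually.of_forall fun _ => p.sum_mem fun i _ => h i)

/-! ### The sines belong to `H¹₀(0, π)` -/

theorem norm_contL2_sq {f : ℝ → ℝ} (hf : Continuous f) : ‖contL2 hf‖ ^ 2 = ∫ x, f x ^ 2 ∂μI := by
  rw [← real_inner_self_eq_norm_sq, inner_contL2_contL2, integral_μI]
  simp_rw [sq]

theorem contL2_sub {f g : ℝ → ℝ} (hf : Continuous f) (hg : Continuous g) :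
    contL2 hf - contL2 hg = contL2 (hf.sub hg) := rfl

/-- Dominated convergence for continuous functions in `L²(0, π)`. -/
theorem tendsto_contL2 {F : ℕ → ℝ → ℝ} {f : ℝ → ℝ} (hF : ∀ n, Continuous (F n))
    (hf : Continuous f) {C : ℝ} (hC : ∀ n, ∀ x ∈ Ioo 0 Real.pi, |F n x| ≤ C)
    (h : ∀ x ∈ Ioo 0 Real.pi, Tendsto (fun n => F n x) atTop (𝓝 (f x))) :
    Tendsto (fun n => contL2 (hF n)) atTop (𝓝 (contL2 hf)) := by
  rw [tendsto_iff_norm_sub_tendsto_zero]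
  have hsq : Tendsto (fun n => ‖contL2 (hF n) - contL2 hf‖ ^ 2) atTop (𝓝 0) := by
    simp_rw [contL2_sub, norm_contL2_sq]
    have key := tendsto_integral_of_dominated_convergence (μ := μI)
      (F := fun n x => (F n - f) x ^ 2) (f := fun _ => (0 : ℝ)) (fun _ => (2 * C) ^ 2)
      (fun n => (((hF n).sub hf).pow 2).aestronglyMeasurable) (integrable_const _) ?_ ?_
    · simpa using key
    · intro n
      rw [ae_restrict_iff' measurableSet_Ioo]
      refine Eventually.of_forall fun x hx => ?_
      have h1 := hC n x hx
      have h2 : |f x| ≤ C := le_of_tendsto (h x hx).abs (Eventually.of_forall fun n => hC n x hx)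
      rw [Real.norm_eq_abs, abs_of_nonneg (sq_nonneg _), ← sq_abs, Pi.sub_apply]
      have h3 := abs_sub (F n x) (f x)
      gcongr
      linarith
    · rw [ae_restrict_iff' measurableSet_Ioo]
      refine Eventually.of_forall fun x hx => ?_
      have := ((h x hx).sub_const (f x)).pow 2
      simpa using this
  simpa using hsq.sqrt

theorem deriv_smoothTransition_of_neg {y : ℝ} (hy : y < 0) :
    deriv Real.smoothTransition y = 0 := by
  refine (EventuallyEq.deriv_eq (f := fun _ => (0 : ℝ)) ?_).trans (deriv_const _ _)
  filter_upwards [gt_mem_nhds hy] with x hx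
  exact Real.smoothTransition.zero_of_nonpos hx.le

theorem deriv_smoothTransition_of_one_lt {y : ℝ} (hy : 1 < y) :
    deriv Real.smoothTransition y = 0 := by
  refine (EventuallyEq.deriv_eq (f := fun _ => (1 : ℝ)) ?_).trans (deriv_const _ _)
  filter_upwards [lt_mem_nhds hy] with x hx
  exact Real.smoothTransition.one_of_one_le hx.le

theorem exists_abs_deriv_smoothTransition_le : ∃ C, ∀ y, |deriv Real.smoothTransition y| ≤ C := by
  have hc : Continuous (deriv Real.smoothTransition) :=
    (Real.smoothTransition.contDiff (n := ⊤)).continuous_deriv (by simp)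
  obtain ⟨C, hC⟩ := isCompact_Icc.exists_bound_of_continuousOn (s := Icc (0 : ℝ) 1) hc.continuousOn
  refine ⟨C, fun y => ?_⟩
  have hC0 : 0 ≤ C := (norm_nonneg _).trans (hC 0 (by simp))
  rcases lt_or_ge y 0 with h0 | h0
  · rwa [deriv_smoothTransition_of_neg h0, abs_zero]
  rcases lt_or_ge 1 y with h1 | h1
  · rwa [deriv_smoothTransition_of_one_lt h1, abs_zero]
  exact hC y ⟨h0, h1⟩

/-- Smooth cutoff functions on `(0, π)`. -/
def cutoff (n : ℕ) (x : ℝ) : ℝ :=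
  Real.smoothTransition ((n + 1) * (x * (Real.pi - x)) - 1)

theorem contDiff_cutoff (n : ℕ) : ContDiff ℝ ∞ (cutoff n) :=
  (Real.smoothTransition.contDiff (n := ⊤)).comp (by fun_prop)

theorem hasDerivAt_cutoff (n : ℕ) (x : ℝ) : HasDerivAt (cutoff n)
    (deriv Real.smoothTransition ((n + 1) * (x * (Real.pi - x)) - 1) *
      ((n + 1) * (Real.pi - 2 * x))) x := by
  have h1 : HasDerivAt (fun x : ℝ => ((n : ℝ) + 1) * (x * (Real.pi - x)) - 1)
      ((n + 1) * (Real.pi - 2 * x)) x := by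
    have := (((hasDerivAt_id x).mul ((hasDerivAt_id x).const_sub Real.pi)).const_mul
      ((n : ℝ) + 1)).sub_const 1
    refine this.congr_deriv ?_
    simp only [id]
    ring
  have h2 := (((Real.smoothTransition.contDiff (n := ⊤)).differentiable (by simp))
    (((n : ℝ) + 1) * (x * (Real.pi - x)) - 1)).hasDerivAt
  exact h2.comp x h1

theorem isTest_cutoff_mul (n : ℕ) {v : ℝ → ℝ} (hv : ContDiff ℝ ∞ v) :
    IsTest fun x => cutoff n x * v x := by
  have hsub : tsupport (fun x => cutoff n x * v x) ⊆
      {x | 1 ≤ ((n : ℝ) + 1) * (x * (Real.pi - x))} := by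
    refine closure_minimal (fun x hx => ?_) (isClosed_le continuous_const (by fun_prop))
    by_contra hlt
    refine hx ?_
    simp only [mem_ofPred_eq, not_le] at hlt
    simp only [cutoff]
    rw [Real.smoothTransition.zero_of_nonpos (by linarith), zero_mul]
  have hIoo : tsupport (fun x => cutoff n x * v x) ⊆ Ioo 0 Real.pi := fun x hx => by
    have h1 : 1 ≤ ((n : ℝ) + 1) * (x * (Real.pi - x)) := hsub hx
    have h2 : 0 < x * (Real.pi - x) :=
      pos_of_mul_pos_right (lt_of_lt_of_le one_pos h1) (by positivity)
    rcases mul_pos_iff.1 h2 with h | h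
    · exact ⟨h.1, by linarith [h.2]⟩
    · linarith [h.1, h.2, Real.pi_pos]
  refine ⟨(contDiff_cutoff n).mul hv, ?_, hIoo⟩
  exact isCompact_Icc.of_isClosed_subset (isClosed_tsupport _) (hIoo.trans Ioo_subset_Icc_self)

theorem eventually_one_lt_cutoff_arg {x : ℝ} (hx : x ∈ Ioo 0 Real.pi) :
    ∀ᶠ n : ℕ in atTop, 1 < ((n : ℝ) + 1) * (x * (Real.pi - x)) - 1 := by
  have hpos : 0 < x * (Real.pi - x) := mul_pos hx.1 (by linarith [hx.2])
  have h : Tendsto (fun n : ℕ => ((n : ℝ) + 1) * (x * (Real.pi - x)) - 1) atTop atTop :=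
    tendsto_atTop_add_const_right _ _ ((tendsto_atTop_add_const_right _ _
      tendsto_natCast_atTop_atTop).atTop_mul_const hpos)
  exact h.eventually_gt_atTop 1

/-- A smooth function vanishing at the end points of `(0, π)` belongs to `H¹₀(0, π)`. -/
theorem contL2_mem_closure {v : ℝ → ℝ} (hv : ContDiff ℝ ∞ v) {M : ℝ}
    (hM : ∀ x ∈ Ioo 0 Real.pi, |v x| ≤ M * (x * (Real.pi - x))) :
    (contL2 hv.continuous, contL2 (hv.continuous_deriv (by simp))) ∈
      testPairs.topologicalClosure := by
  have hderiv : ∀ n x, deriv (fun x => cutoff n x * v x) x =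
      deriv Real.smoothTransition ((n + 1) * (x * (Real.pi - x)) - 1) *
        ((n + 1) * (Real.pi - 2 * x)) * v x + cutoff n x * deriv v x := fun n x =>
    ((hasDerivAt_cutoff n x).mul ((hv.differentiable (by simp)) x).hasDerivAt).deriv
  have hcut : ∀ n x, |cutoff n x| ≤ 1 := fun n x => by
    rw [cutoff, abs_of_nonneg (Real.smoothTransition.nonneg _)]
    exact Real.smoothTransition.le_one _
  obtain ⟨C, hC⟩ := exists_abs_deriv_smoothTransition_le
  have hC0 : 0 ≤ C := (abs_nonneg _).trans (hC 0)
  have hM0 : 0 ≤ M := by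
    have h1 := (abs_nonneg _).trans (hM (Real.pi / 2) ⟨by positivity, by linarith [Real.pi_pos]⟩)
    exact nonneg_of_mul_nonneg_left h1 (by have := Real.pi_pos; nlinarith)
  obtain ⟨V, hV⟩ := isCompact_Icc.exists_bound_of_continuousOn (s := Icc 0 Real.pi)
    hv.continuous.continuousOn
  obtain ⟨W, hW⟩ := isCompact_Icc.exists_bound_of_continuousOn (s := Icc 0 Real.pi)
    (hv.continuous_deriv (by simp)).continuousOn
  have h1 : Tendsto (fun n => contL2 (isTest_cutoff_mul n hv).continuous) atTop
      (𝓝 (contL2 hv.continuous)) := by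
    refine tendsto_contL2 _ _ (C := V) (fun n x hx => ?_) fun x hx => ?_
    · rw [abs_mul]
      have := hV x (Ioo_subset_Icc_self hx)
      exact (mul_le_of_le_one_left (abs_nonneg _) (hcut n x)).trans this
    · refine tendsto_const_nhds.congr' ?_
      filter_upwards [eventually_one_lt_cutoff_arg hx] with n hn
      rw [cutoff, Real.smoothTransition.one_of_one_le hn.le, one_mul]
  have h2 : Tendsto (fun n => contL2 (isTest_cutoff_mul n hv).continuous_deriv) atTop
      (𝓝 (contL2 (hv.continuous_deriv (by simp)))) := by
    refine tendsto_contL2 _ _ (C := 2 * C * Real.pi * M + W) (fun n x hx => ?_) fun x hx => ?_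
    · rw [hderiv]
      refine (abs_add_le _ _).trans (add_le_add ?_ ?_)
      -- The derivative of the cutoff is of size `n + 1`, but it is supported where `y ≤ 1`, that is
      -- `(n + 1) x (π - x) ≤ 2`. The decay `|v x| ≤ M x (π - x)` absorbs the factor, uniformly in
      -- `n`.
      · set y : ℝ := (n + 1) * (x * (Real.pi - x)) - 1 with hy
        rcases lt_or_ge 1 y with h | h
        · rw [deriv_smoothTransition_of_one_lt h, zero_mul, zero_mul, abs_zero]
          positivity
        · have hn : (0 : ℝ) < n + 1 := by positivity
          have h3 : |Real.pi - 2 * x| ≤ Real.pi := by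
            rw [abs_le]
            constructor <;> linarith [hx.1, hx.2]
          rw [abs_mul, abs_mul, abs_mul, abs_of_pos hn]
          calc |deriv Real.smoothTransition y| * ((n + 1) * |Real.pi - 2 * x|) * |v x|
              ≤ C * ((n + 1) * Real.pi) * (M * (x * (Real.pi - x))) := by
                gcongr
                · exact hC y
                · exact hM x hx
            _ = C * Real.pi * M * (y + 1) := by rw [hy]; ring
            _ ≤ C * Real.pi * M * 2 := by
                have := Real.pi_pos
                gcongr
                linarith
            _ = 2 * C * Real.pi * M := by ring
      · rw [abs_mul]
        have := hW x (Ioo_subset_Icc_self hx)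
        exact (mul_le_of_le_one_left (abs_nonneg _) (hcut n x)).trans this
    · refine tendsto_const_nhds.congr' ?_
      filter_upwards [eventually_one_lt_cutoff_arg hx] with n hn
      rw [hderiv, cutoff, Real.smoothTransition.one_of_one_le hn.le,
        deriv_smoothTransition_of_one_lt hn]
      ring
  exact mem_closure_of_tendsto (h1.prodMk_nhds h2)
    (Eventually.of_forall fun n => mem_testPairs_of_isTest (isTest_cutoff_mul n hv))

/-- Comparison with the distance to each end point gives the bounds `m x` and `m (π - x)`. Weighting
them by `π - x` and `x` and adding produces the factor `2 / π`. -/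
theorem abs_sin_nat_mul_le (m : ℕ) {x : ℝ} (hx : x ∈ Ioo 0 Real.pi) :
    |Real.sin (m * x)| ≤ m * (2 / Real.pi) * (x * (Real.pi - x)) := by
  have h1 : |Real.sin (m * x)| ≤ m * x := by
    refine Real.abs_sin_le_abs.trans_eq (abs_of_nonneg ?_)
    have := hx.1
    positivity
  have h2 : |Real.sin (m * x)| ≤ m * (Real.pi - x) := by
    have h3 : |Real.sin (m * x)| = |Real.sin (m * (Real.pi - x))| := by
      rw [mul_sub, Real.sin_nat_mul_pi_sub, abs_neg, abs_mul, abs_pow]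
      simp
    rw [h3]
    refine Real.abs_sin_le_abs.trans_eq (abs_of_nonneg ?_)
    have : 0 ≤ Real.pi - x := by linarith [hx.2]
    positivity
  have hpi := Real.pi_pos
  have hm : (0 : ℝ) ≤ m := m.cast_nonneg
  rw [mul_assoc, div_mul_eq_mul_div, mul_div_assoc', le_div_iff₀ hpi]
  have hx0 := hx.1.le
  have hx1 : 0 ≤ Real.pi - x := by linarith [hx.2]
  nlinarith [mul_le_mul_of_nonneg_right h1 hx1, mul_le_mul_of_nonneg_right h2 hx0]

theorem hasDerivAt_sinVec (k : ℕ) (x : ℝ) :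
    HasDerivAt (fun x : ℝ => nrm * Real.sin ((k + 1) * x))
      (((k : ℝ) + 1) * (nrm * Real.cos ((k + 1) * x))) x := by
  have h := ((((hasDerivAt_id x).const_mul ((k : ℝ) + 1)).sin).const_mul nrm)
  refine h.congr_deriv ?_
  simp
  ring

theorem hasDerivAt_cosVec (k : ℕ) (x : ℝ) :
    HasDerivAt (fun x : ℝ => nrm * Real.cos ((k + 1) * x))
      (-((k : ℝ) + 1) * (nrm * Real.sin ((k + 1) * x))) x := by
  have h := ((((hasDerivAt_id x).const_mul ((k : ℝ) + 1)).cos).const_mul nrm)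
  refine h.congr_deriv ?_
  simp
  ring

theorem contL2_const_mul (c : ℝ) {f : ℝ → ℝ} (hf : Continuous f) :
    contL2 (f := fun x => c * f x) (continuous_const.mul hf) = c • contL2 hf := rfl

theorem sinVec_mem_closure (k : ℕ) :
    (sinVec k, ((k : ℝ) + 1) • cosVec k) ∈ testPairs.topologicalClosure := by
  have hv : ContDiff ℝ ∞ fun x : ℝ => nrm * Real.sin ((k + 1) * x) := by fun_prop
  have h := contL2_mem_closure hv (M := nrm * (((k + 1 : ℕ) : ℝ) * (2 / Real.pi))) fun x hx => by
    rw [abs_mul, abs_of_pos nrm_pos, mul_assoc]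
    have h1 := abs_sin_nat_mul_le (k + 1) hx
    push_cast at h1 ⊢
    exact mul_le_mul_of_nonneg_left h1 nrm_pos.le
  have hd : ((k : ℝ) + 1) • cosVec k = contL2 (hv.continuous_deriv (by simp)) := by
    rw [cosVec, ← contL2_const_mul]
    congr 1
    funext x
    exact (hasDerivAt_sinVec k x).deriv.symm
  rw [hd]
  exact h

theorem hasWeakDeriv_cosVec (k : ℕ) :
    HasWeakDeriv (cosVec k) (-((k : ℝ) + 1) • sinVec k) := by
  rw [sinVec, ← contL2_const_mul]
  exact hasWeakDeriv_contL2 (hasDerivAt_cosVec k) _ _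

/-! ### Spectral description of the Dirichlet Laplacian -/

/-- Forwards, integrate by parts twice: `z ∈ H¹₀` removes the boundary term against the cosine, and
the sine lying in `H¹₀` removes it against `g`. Backwards, the sine series of `z` can be
differentiated termwise twice, because the graphs involved are closed and the series of derivatives
converge. -/
theorem mem_laplacianGraph_iff (z w : L2I) : (z, w) ∈ laplacianGraph ↔
    ∀ k, ⟪sinBasis k, w⟫_ℝ = -((k : ℝ) + 1) ^ 2 * ⟪sinBasis k, z⟫_ℝ := by
  constructor
  · rintro ⟨hz, g, h1, h2⟩ k
    obtain ⟨p, hp, hpz⟩ := (Submodule.mem_map).1 hz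
    -- `H10` and the second-derivative condition each supply a first derivative of `z`; uniqueness
    -- of weak derivatives identifies them.
    obtain rfl : p = (z, g) := Prod.ext hpz
      (HasWeakDeriv.unique (f := z) (by
        rw [← show p.1 = z from hpz]
        exact hasWeakDeriv_of_mem_closure hp) h1)
    have h3 := (hasWeakDeriv_cosVec k).inner_of_mem_closure hp
    have h4 := h2.inner_of_mem_closure (sinVec_mem_closure k)
    simp only [inner_smul_left, inner_smul_right] at h3 h4
    rw [real_inner_comm] at h3
    rw [h3] at h4
    rw [sinBasis_apply, real_inner_comm]
    simp at h4
    linarith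
  · intro h
    have hz := sinBasis.hasSum_repr z
    have hw := sinBasis.hasSum_repr w
    simp only [sinBasis.repr_apply_apply, sinBasis_apply] at hz hw
    simp only [sinBasis_apply] at h
    have hsum : Summable fun k : ℕ => (((k : ℝ) + 1) * ⟪sinVec k, z⟫_ℝ) • cosVec k := by
      have := (orthonormal_cosVec.orthogonalFamily.summable_iff_norm_sq_summable
        fun k : ℕ => ((k : ℝ) + 1) * ⟪sinVec k, z⟫_ℝ).2 ?_
      · simpa using this
      -- The squares `(k+1)² ⟪sinVec k, z⟫²` are the terms of `-⟪z, w⟫`, hence summable.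
      · refine ((sinBasis.hasSum_inner_mul_inner z w).summable.neg).congr fun k => ?_
        rw [sinBasis_apply, h, real_inner_comm, Real.norm_eq_abs, sq_abs]
        ring
    obtain ⟨g, hg⟩ := hsum
    have hcl : (z, g) ∈ testPairs.topologicalClosure :=
      Submodule.mem_of_hasSum (Submodule.isClosed_topologicalClosure _) (hz.prodMk hg) fun k => by
        have := testPairs.topologicalClosure.smul_mem ⟪sinVec k, z⟫_ℝ (sinVec_mem_closure k)
        rwa [Prod.smul_mk, smul_smul, mul_comm] at this
    refine ⟨⟨(z, g), hcl, rfl⟩, g, hasWeakDeriv_of_mem_closure hcl, ?_⟩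
    refine Submodule.mem_of_hasSum (p := weakDerivGraph) isClosed_hasWeakDeriv
      (hg.prodMk hw) fun k => ?_
    have := weakDerivGraph.smul_mem (((k : ℝ) + 1) * ⟪sinVec k, z⟫_ℝ)
      (show (cosVec k, -((k : ℝ) + 1) • sinVec k) ∈ weakDerivGraph from hasWeakDeriv_cosVec k)
    rw [Prod.smul_mk, smul_smul] at this
    rw [h]
    convert this using 3
    ring

/-- The eigenvalues of `-Δ`. -/
def lapEig (k : ℕ) : ℝ := ((k : ℝ) + 1) ^ 2

theorem lapEig_nonneg (k : ℕ) : 0 ≤ lapEig k := sq_nonneg _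

theorem lapEig_injective : Function.Injective lapEig := fun j k h => by
  have h1 : ((j : ℝ) + 1) = k + 1 := (sq_eq_sq₀ (by positivity) (by positivity)).1 h
  exact_mod_cast (add_right_cancel h1)

theorem mem_graph_dirichletLaplacian_iff (z w : L2I) : (z, w) ∈ dirichletLaplacian.graph ↔
    ∀ k, ⟪sinBasis k, w⟫_ℝ = -lapEig k * ⟪sinBasis k, z⟫_ℝ := by
  rw [dirichletLaplacian_graph]
  exact mem_laplacianGraph_iff z w

/-- The heat semigroup on `L²(0, π)`. -/
abbrev heatSemigroup : ℝ → L2I →L[ℝ] L2I := diagonalSemigroup sinBasis lapEig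

theorem generates_heatSemigroup : Generates dirichletLaplacian heatSemigroup :=
  generates_diagonalSemigroup lapEig_nonneg mem_graph_dirichletLaplacian_iff

theorem Generates.eq_heatSemigroup {S : ℝ → L2I →L[ℝ] L2I} (hS : Generates dirichletLaplacian S)
    {t : ℝ} (ht : 0 ≤ t) : S t = heatSemigroup t :=
  hS.eq_diagonalSemigroup lapEig_injective lapEig_nonneg mem_graph_dirichletLaplacian_iff ht

/-! ### A scalar Volterra equation -/

/-- The integral equation makes `ψ * exp (-G)` constant. The base point `a` may be either end of the
interval, which serves both the forward equation and the backward adjoint equation. -/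
theorem eq_mul_exp_of_volterra {d G ψ : ℝ → ℝ} {l u a c : ℝ} (hd : Continuous d)
    (hG : ∀ t, HasDerivAt G (d t) t) (ha : a ∈ Icc l u) (hψ : ContinuousOn ψ (Icc l u))
    (h : ∀ t ∈ Icc l u, ψ t = c + ∫ r in a..t, d r * ψ r) {t : ℝ} (ht : t ∈ Icc l u) :
    ψ t = c * Real.exp (G t - G a) := by
  have hlu : l ≤ u := ha.1.trans ha.2
  -- Extending `ψ` continuously to the line makes the integral differentiable everywhere, so end
  -- points need no separate treatment.
  set χ : ℝ → ℝ := IccExtend hlu ((Icc l u).domRestrict ψ) with hχ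
  have hχc : Continuous χ := (continuousOn_iff_continuous_domRestrict.1 hψ).Icc_extend'
  have hχeq : ∀ r ∈ Icc l u, χ r = ψ r := fun r hr => IccExtend_of_mem hlu _ hr
  set Ψ : ℝ → ℝ := fun t => c + ∫ r in a..t, d r * χ r with hΨ
  have hΨeq : ∀ r ∈ Icc l u, Ψ r = ψ r := fun r hr => by
    rw [h r hr, hΨ]
    refine congrArg (c + ·) ?_
    refine intervalIntegral.integral_congr fun x hx => ?_
    rw [hχeq x (uIcc_subset_Icc ha hr hx)]
  have hΨd : ∀ r, HasDerivAt Ψ (d r * χ r) r := fun r =>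
    ((hd.mul hχc).integral_hasStrictDerivAt a r).hasDerivAt.const_add c
  have hq : ∀ r, HasDerivAt (fun r => Ψ r * Real.exp (-G r))
      (d r * χ r * Real.exp (-G r) + Ψ r * (Real.exp (-G r) * -d r)) r := fun r =>
    (hΨd r).mul (hG r).neg.exp
  have hconst := constant_of_has_deriv_right_zero (a := l) (b := u)
    (f := fun r => Ψ r * Real.exp (-G r))
    (fun r _ => (hq r).continuousAt.continuousWithinAt) fun r hr => by
      refine (hq r).hasDerivWithinAt.congr_deriv ?_
      rw [hΨeq r (Ico_subset_Icc_self hr), hχeq r (Ico_subset_Icc_self hr)]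
      ring
  have h1 := (hconst t ht).trans (hconst a ha).symm
  have h2 : Ψ a = c := by simp [hΨ]
  simp only [hΨeq t ht, h2] at h1
  rw [sub_eq_add_neg, Real.exp_add, mul_comm (Real.exp (G t)), ← mul_assoc, ← h1, mul_assoc,
    ← Real.exp_add, neg_add_cancel, Real.exp_zero, mul_one]

/-! ### The potential `3 sin² t` and its primitive -/

/-- A primitive of `3 sin² t`. -/
def prim (t : ℝ) : ℝ := 3 / 2 * (t - Real.sin t * Real.cos t)

theorem hasDerivAt_prim (t : ℝ) : HasDerivAt prim (3 * Real.sin t ^ 2) t := by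
  have h := ((hasDerivAt_id t).sub ((Real.hasDerivAt_sin t).mul (Real.hasDerivAt_cos t))).const_mul
    (3 / 2 : ℝ)
  refine h.congr_deriv ?_
  have := Real.sin_sq_add_cos_sq t
  linear_combination -(3 / 2 : ℝ) * this

theorem continuous_prim : Continuous prim := by
  unfold prim
  fun_prop

theorem continuous_potential : Continuous fun t : ℝ => 3 * Real.sin t ^ 2 := by
  fun_prop

/-- The difference is `-(3/2) sin t cos t`, and `|sin t cos t| ≤ 1/2`. All growth and decay rates
below come from the mean value `3/2` of the potential. -/
theorem abs_prim_sub_le (t : ℝ) : |prim t - 3 / 2 * t| ≤ 3 / 4 := by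
  have h1 := Real.sin_sq_add_cos_sq t
  rw [prim, abs_le]
  constructor <;>
    nlinarith [sq_nonneg (Real.sin t - Real.cos t), sq_nonneg (Real.sin t + Real.cos t)]

theorem monotone_prim : Monotone prim :=
  monotone_of_deriv_nonneg (fun t => (hasDerivAt_prim t).differentiableAt) fun t => by
    rw [(hasDerivAt_prim t).deriv]
    positivity

theorem prim_zero : prim 0 = 0 := by simp [prim]

theorem prim_pi : prim Real.pi = 3 / 2 * Real.pi := by simp [prim]

/-! ### Explicit evolution systems -/

/-- The evolution system with eigenvalues `exp (∫ₛᵗ 3 sin² - μ k (t - s))`. -/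
def diagonalEvolution (μ : ℕ → ℝ) (t s : ℝ) : L2I →L[ℝ] L2I :=
  Real.exp (prim t - prim s) • diagonalSemigroup sinBasis μ (t - s)

theorem inner_intervalIntegral (e : L2I) {f : ℝ → L2I} {s t : ℝ}
    (hf : IntervalIntegrable f volume s t) :
    ⟪e, ∫ r in s..t, f r⟫_ℝ = ∫ r in s..t, ⟪e, f r⟫_ℝ :=
  ((innerSL ℝ e).intervalIntegral_comp_comm hf).symm

theorem inner_diagonalEvolution {μ : ℕ → ℝ} (hμ : ∀ k, 0 ≤ μ k) {t s : ℝ} (hst : s ≤ t) (k : ℕ)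
    (z : L2I) : ⟪sinBasis k, diagonalEvolution μ t s z⟫_ℝ =
      Real.exp (prim t - prim s - μ k * (t - s)) * ⟪sinBasis k, z⟫_ℝ := by
  rw [diagonalEvolution, smul_apply, inner_smul_right,
    inner_diagonalSemigroup_of_nonneg hμ (sub_nonneg.2 hst), ← mul_assoc, ← Real.exp_add]
  ring_nf

/-- Allowing rates `μ` other than the eigenvalues covers the free system (`μ = lapEig`) and the
closed loop at once: the discrepancy `lapEig k - μ k` is the diagonal feedback contained in `F`. -/
theorem isEvolutionSystem_diagonalEvolution {μ : ℕ → ℝ} (hμ : ∀ k, 0 ≤ μ k)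
    {F : ℝ → L2I →L[ℝ] L2I} (hFc : Continuous F)
    (hF : ∀ r k z, ⟪sinBasis k, F r z⟫_ℝ =
      (3 * Real.sin r ^ 2 + (lapEig k - μ k)) * ⟪sinBasis k, z⟫_ℝ) :
    IsEvolutionSystem dirichletLaplacian F (diagonalEvolution μ) := by
  refine ⟨heatSemigroup, generates_heatSemigroup, fun s _ => ?_, fun t r s _ hsr hrt => ?_,
    fun z => ?_, fun t s hs hst z => ?_⟩
  · simp [diagonalEvolution, diagonalSemigroup_zero hμ]
  · ext1 z
    refine hilbertBasis_ext sinBasis fun k => ?_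
    rw [ContinuousLinearMap.comp_apply, inner_diagonalEvolution hμ (hsr.trans hrt),
      inner_diagonalEvolution hμ hrt, inner_diagonalEvolution hμ hsr, ← mul_assoc, ← Real.exp_add]
    ring_nf
  · have hp := continuous_prim
    have h1 : Continuous fun p : ℝ × ℝ => Real.exp (prim p.1 - prim p.2) := by fun_prop
    have h2 := (continuous_diagonalSemigroup_apply (b := sinBasis) hμ z).comp
      (continuous_fst.sub continuous_snd : Continuous fun p : ℝ × ℝ => p.1 - p.2)
    exact (h1.smul h2).continuousOn
  · have hcont : ContinuousOn
        (fun r => heatSemigroup (t - r) (F r (diagonalEvolution μ r s z))) (uIcc s t) := by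
      refine continuousOn_diagonalSemigroup lapEig_nonneg (by fun_prop)
        (Continuous.continuousOn ?_)
      refine hFc.clm_apply ?_
      have hp := continuous_prim
      have h1 : Continuous fun r => Real.exp (prim r - prim s) := by fun_prop
      exact h1.smul ((continuous_diagonalSemigroup_apply hμ z).comp
        (continuous_id.sub continuous_const))
    refine hilbertBasis_ext sinBasis fun k => ?_
    rw [inner_add_right, inner_intervalIntegral _ hcont.intervalIntegrable,
      inner_diagonalEvolution hμ hst, inner_diagonalSemigroup_of_nonneg lapEig_nonneg
        (sub_nonneg.2 hst)]
    have hcongr : ∫ r in s..t,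
        ⟪sinBasis k, heatSemigroup (t - r) (F r (diagonalEvolution μ r s z))⟫_ℝ =
        ∫ r in s..t, (3 * Real.sin r ^ 2 + (lapEig k - μ k)) *
          Real.exp (-lapEig k * (t - r) + (prim r - prim s - μ k * (r - s))) *
            ⟪sinBasis k, z⟫_ℝ := by
      refine intervalIntegral.integral_congr fun r hr => ?_
      rw [uIcc_of_le hst] at hr
      rw [inner_diagonalSemigroup_of_nonneg lapEig_nonneg (sub_nonneg.2 hr.2), hF,
        inner_diagonalEvolution hμ hr.1, Real.exp_add]
      ring
    -- In each mode the Duhamel integrand is an exact derivative: letting the system evolve up to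
    -- time `r` and the semigroup act from `r` to `t` interpolates between the two sides.
    rw [hcongr, intervalIntegral.integral_eq_sub_of_hasDerivAt (f := fun r =>
      Real.exp (-lapEig k * (t - r) + (prim r - prim s - μ k * (r - s))) * ⟪sinBasis k, z⟫_ℝ)]
    · simp only [sub_self, mul_zero, zero_add, add_zero]
      ring
    · intro r _
      have h1 := (((hasDerivAt_id r).const_sub t).const_mul (-lapEig k)).add
        (((hasDerivAt_prim r).sub_const (prim s)).sub
          (((hasDerivAt_id r).sub_const s).const_mul (μ k)))
      refine (h1.exp.mul_const ⟪sinBasis k, z⟫_ℝ).congr_deriv ?_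
      simp only [id, Pi.add_apply, Pi.sub_apply]
      ring
    · have hp := continuous_prim
      exact Continuous.intervalIntegrable (by fun_prop) _ _

theorem lapEig_zero : lapEig 0 = 1 := by simp [lapEig]

theorem four_le_lapEig {k : ℕ} (hk : k ≠ 0) : 4 ≤ lapEig k := by
  have : (1 : ℝ) ≤ k := by exact_mod_cast Nat.one_le_iff_ne_zero.2 hk
  rw [lapEig]
  nlinarith

/-! ### The uncontrolled heat equation -/

theorem heatSystem_D_apply (t : ℝ) (z : L2I) : heatSystem.D t z = (3 * Real.sin t ^ 2) • z := rfl

theorem continuous_heatSystem_D : Continuous heatSystem.D := by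
  exact continuous_potential.smul continuous_const

theorem isPeriodic_heatSystem : heatSystem.IsPeriodic where
  T_pos := Real.pi_pos
  generates := ⟨_, generates_heatSemigroup⟩
  D_locallyIntegrable := continuous_heatSystem_D.locallyIntegrable.locallyIntegrableOn _
  D_periodic := Eventually.of_forall fun t => by
    simp only [heatSystem, Real.sin_add_pi, neg_sq]
  B_bounded := memLp_top_const _
  B_periodic := Eventually.of_forall fun _ => rfl

theorem isEvolution_diagonalEvolution :
    heatSystem.IsEvolution (diagonalEvolution lapEig) :=
  isEvolutionSystem_diagonalEvolution lapEig_nonneg continuous_heatSystem_D fun r k z => by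
    rw [heatSystem_D_apply, inner_smul_right, sub_self, add_zero]

/-- Multiplying the mild equation in mode `k` by `exp (lapEig k * (τ - s))` cancels the semigroup
and leaves a scalar Volterra equation. This determines every evolution system, so later claims do
not depend on the choice of `Φ`. -/
theorem ControlSystem.IsEvolution.inner_apply {Φ : ℝ → ℝ → L2I →L[ℝ] L2I}
    (hΦ : heatSystem.IsEvolution Φ) {t s : ℝ} (hs : 0 ≤ s) (hst : s ≤ t) (k : ℕ) (z : L2I) :
    ⟪sinBasis k, Φ t s z⟫_ℝ =
      Real.exp (prim t - prim s - lapEig k * (t - s)) * ⟪sinBasis k, z⟫_ℝ := by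
  obtain ⟨S, hS, -, -, hcont, hint⟩ := hΦ
  have hΦc : ContinuousOn (fun r => Φ r s z) (Icc s t) :=
    (hcont z).comp (f := fun r => (r, s)) (by fun_prop) fun r hr => ⟨hs, hr.1⟩
  have hc : ∀ τ ∈ Icc s t, Real.exp (lapEig k * (τ - s)) * ⟪sinBasis k, Φ τ s z⟫_ℝ =
      ⟪sinBasis k, z⟫_ℝ + ∫ r in s..τ, 3 * Real.sin r ^ 2 *
        (Real.exp (lapEig k * (r - s)) * ⟪sinBasis k, Φ r s z⟫_ℝ) := by
    intro τ hτ
    have hsub : Icc s τ ⊆ Icc s t := Icc_subset_Icc_right hτ.2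
    have h1 : ∫ r in s..τ, S (τ - r) (heatSystem.D r (Φ r s z)) =
        ∫ r in s..τ, heatSemigroup (τ - r) ((3 * Real.sin r ^ 2) • Φ r s z) :=
      intervalIntegral.integral_congr fun r hr => by
        rw [uIcc_of_le hτ.1] at hr
        rw [hS.eq_heatSemigroup (sub_nonneg.2 hr.2), heatSystem_D_apply]
    have h2 : ContinuousOn (fun r => heatSemigroup (τ - r) ((3 * Real.sin r ^ 2) • Φ r s z))
        (uIcc s τ) := by
      rw [uIcc_of_le hτ.1]
      refine continuousOn_diagonalSemigroup lapEig_nonneg (by fun_prop) ?_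
      exact continuous_potential.continuousOn.smul (hΦc.mono hsub)
    rw [hint τ s hs hτ.1 z, h1, hS.eq_heatSemigroup (sub_nonneg.2 hτ.1), inner_add_right,
      inner_intervalIntegral _ h2.intervalIntegrable, mul_add,
      inner_diagonalSemigroup_of_nonneg lapEig_nonneg (sub_nonneg.2 hτ.1), ← mul_assoc,
      ← Real.exp_add, ← intervalIntegral.integral_const_mul]
    congr 1
    · rw [neg_mul, add_neg_cancel, Real.exp_zero, one_mul]
    · refine intervalIntegral.integral_congr fun r hr => ?_
      rw [uIcc_of_le hτ.1] at hr
      rw [inner_diagonalSemigroup_of_nonneg lapEig_nonneg (sub_nonneg.2 hr.2), inner_smul_right,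
        ← mul_assoc, ← Real.exp_add,
        show lapEig k * (τ - s) + -lapEig k * (τ - r) = lapEig k * (r - s) by ring]
      ring
  have h := eq_mul_exp_of_volterra (d := fun r => 3 * Real.sin r ^ 2) (by fun_prop)
    hasDerivAt_prim (left_mem_Icc.2 hst)
    (ψ := fun r => Real.exp (lapEig k * (r - s)) * ⟪sinBasis k, Φ r s z⟫_ℝ)
    (ContinuousOn.mul (by fun_prop) (continuousOn_const.inner hΦc)) hc (right_mem_Icc.2 hst)
  rw [sub_eq_add_neg (prim t - prim s), Real.exp_add, mul_right_comm, mul_comm (Real.exp _),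
    ← h, mul_right_comm, ← Real.exp_add, add_neg_cancel, Real.exp_zero, one_mul]

theorem ControlSystem.IsEvolution.apply_basis {Φ : ℝ → ℝ → L2I →L[ℝ] L2I}
    (hΦ : heatSystem.IsEvolution Φ) {t s : ℝ} (hs : 0 ≤ s) (hst : s ≤ t) (k : ℕ) :
    Φ t s (sinBasis k) = Real.exp (prim t - prim s - lapEig k * (t - s)) • sinBasis k := by
  refine hilbertBasis_ext sinBasis fun j => ?_
  rw [hΦ.inner_apply hs hst, inner_smul_right, hilbertBasis_inner_self]
  split_ifs with h
  · rw [h]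
  · simp

theorem le_norm_evolution {Φ : ℝ → ℝ → L2I →L[ℝ] L2I} (hΦ : heatSystem.IsEvolution Φ) {t : ℝ}
    (ht : 0 ≤ t) : Real.exp (1 / 2 * t - 3 / 4) ≤ ‖Φ t 0 (sinBasis 0)‖ := by
  rw [hΦ.apply_basis le_rfl ht, norm_smul, sinBasis.orthonormal.1 0, mul_one, Real.norm_eq_abs,
    Real.abs_exp, lapEig_zero, prim_zero]
  have := (abs_le.1 (abs_prim_sub_le t)).1
  exact Real.exp_le_exp.2 (by linarith)

theorem tendsto_norm_evolution {Φ : ℝ → ℝ → L2I →L[ℝ] L2I} (hΦ : heatSystem.IsEvolution Φ) :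
    Tendsto (fun t => ‖Φ t 0 (sinBasis 0)‖) atTop atTop := by
  refine tendsto_atTop_mono' _ ?_ (Real.tendsto_exp_atTop.comp (tendsto_atTop_add_const_right _
    (-(3 / 4) : ℝ) ((tendsto_id (α := ℝ)).const_mul_atTop (by norm_num : (0 : ℝ) < 1 / 2))))
  filter_upwards [eventually_ge_atTop 0] with t ht
  exact le_norm_evolution hΦ ht

theorem tendsto_norm_solution {Φ : ℝ → ℝ → L2I →L[ℝ] L2I} (hΦ : heatSystem.IsEvolution Φ) :
    Tendsto (fun t => ‖heatSystem.solution Φ t 0 (sinBasis 0) (fun _ => 0)‖) atTop atTop := by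
  simpa [ControlSystem.solution] using tendsto_norm_evolution hΦ

theorem not_isStable_heatSystem : ¬ IsStable heatSystem.A heatSystem.D := by
  rintro ⟨Φ, hΦ, M, hM, γ, hγ, h⟩
  obtain ⟨t, ht, ht0⟩ := (((tendsto_norm_evolution hΦ).eventually_gt_atTop M).and
    (eventually_ge_atTop 0)).exists
  have h1 := h t 0 le_rfl ht0 (sinBasis 0)
  rw [sinBasis.orthonormal.1 0, mul_one, sub_zero] at h1
  have h2 : Real.exp (-γ * t) ≤ 1 := by
    rw [Real.exp_le_one_iff, neg_mul]
    have := mul_nonneg hγ.le ht0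
    linarith
  nlinarith

/-- Starting from mode 1, the control term stays in the span of mode 0, so the mode 1 coefficient is
a positive exponential at every time. -/
theorem not_isNullControllable_heatSystem : ¬ heatSystem.IsNullControllable := by
  rintro ⟨Φ, hΦ, h⟩
  obtain ⟨τ, hτ, u, -, hsol⟩ := h (sinBasis 1)
  have hint : ∫ r in (0 : ℝ)..τ, Φ τ r (heatSystem.B r (u r)) =
      ∫ r in (0 : ℝ)..τ, (u r * (nrm⁻¹ * Real.exp (prim τ - prim r - lapEig 0 * (τ - r)))) •
        sinBasis 0 := by
    refine intervalIntegral.integral_congr fun r hr => ?_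
    rw [uIcc_of_le hτ.le] at hr
    simp only [heatSystem, ContinuousLinearMap.toSpanSingleton_apply, map_smul, sinL2_eq,
      ← sinBasis_apply]
    rw [hΦ.apply_basis hr.1 hr.2, smul_smul, smul_smul, mul_assoc]
  rw [ControlSystem.solution, hint, intervalIntegral.integral_smul_const] at hsol
  have h1 := congrArg (fun y => ⟪sinBasis 1, y⟫_ℝ) hsol
  simp only [inner_add_right, inner_smul_right, inner_zero_right, hilbertBasis_inner_self,
    hΦ.apply_basis le_rfl hτ.le, if_true, one_ne_zero, if_false, mul_zero, add_zero, mul_one] at h1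
  exact (Real.exp_pos _).ne' h1

/-! ### The adjoint equation -/

theorem adjoint_heatSystem_D_apply (t : ℝ) (z : L2I) :
    (heatSystem.D t).adjoint z = (3 * Real.sin t ^ 2) • z := by
  refine ext_inner_left ℝ fun w => ?_
  rw [ContinuousLinearMap.adjoint_inner_right, heatSystem_D_apply, real_inner_smul_left,
    real_inner_smul_right]

/-- The heat semigroup is self-adjoint and the potential is scalar, so the backward solution is the
heat flow times the exponential of the remaining integral of the potential. -/
theorem exists_isAdjointSolution (n : ℕ) (ψ : L2I) :
    ∃ φ : ℝ → L2I, heatSystem.IsAdjointSolution n ψ φ := by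
  set N : ℝ := n * heatSystem.T with hN
  have hp := continuous_prim
  have hφc : Continuous fun t => Real.exp (prim N - prim t) • heatSemigroup (N - t) ψ := by
    have hexp : Continuous fun t => Real.exp (prim N - prim t) := by fun_prop
    refine hexp.smul ?_
    exact (continuous_diagonalSemigroup_apply lapEig_nonneg ψ).comp
      (continuous_const.sub continuous_id)
  refine ⟨fun t => Real.exp (prim N - prim t) • heatSemigroup (N - t) ψ, heatSemigroup,
    generates_heatSemigroup, hφc.continuousOn, fun t ht => ?_⟩
  rw [← hN] at ht ⊢
  simp only [adjoint_diagonalSemigroup lapEig_nonneg, adjoint_heatSystem_D_apply]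
  have hcont : ContinuousOn (fun r => heatSemigroup (r - t) ((3 * Real.sin r ^ 2) •
      Real.exp (prim N - prim r) • heatSemigroup (N - r) ψ)) (uIcc t N) := by
    refine continuousOn_diagonalSemigroup lapEig_nonneg (by fun_prop) (Continuous.continuousOn ?_)
    exact continuous_potential.smul hφc
  refine hilbertBasis_ext sinBasis fun k => ?_
  rw [inner_add_right, inner_intervalIntegral _ hcont.intervalIntegrable, inner_smul_right,
    inner_diagonalSemigroup_of_nonneg lapEig_nonneg (sub_nonneg.2 ht.2)]
  have hcongr : ∫ r in t..N, ⟪sinBasis k, heatSemigroup (r - t) ((3 * Real.sin r ^ 2) •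
      Real.exp (prim N - prim r) • heatSemigroup (N - r) ψ)⟫_ℝ =
      ∫ r in t..N, 3 * Real.sin r ^ 2 * Real.exp (prim N - prim r) *
        (Real.exp (-lapEig k * (N - t)) * ⟪sinBasis k, ψ⟫_ℝ) := by
    refine intervalIntegral.integral_congr fun r hr => ?_
    rw [uIcc_of_le ht.2] at hr
    rw [inner_diagonalSemigroup_of_nonneg lapEig_nonneg (sub_nonneg.2 hr.1), inner_smul_right,
      inner_smul_right, inner_diagonalSemigroup_of_nonneg lapEig_nonneg (sub_nonneg.2 hr.2),
      show -lapEig k * (N - t) = -lapEig k * (r - t) + -lapEig k * (N - r) by ring, Real.exp_add]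
    ring
  rw [hcongr, intervalIntegral.integral_eq_sub_of_hasDerivAt (f := fun r =>
    -Real.exp (prim N - prim r) * (Real.exp (-lapEig k * (N - t)) * ⟪sinBasis k, ψ⟫_ℝ))]
  · simp only [sub_self, Real.exp_zero]
    ring
  · intro r _
    refine ((((hasDerivAt_prim r).const_sub (prim N)).exp.neg).mul_const _).congr_deriv ?_
    ring
  · exact Continuous.intervalIntegrable (by fun_prop) _ _

/-- Time reversal of the forward argument: the weight is `exp (lapEig k * (N - τ))`, the base point
is the terminal time, and the reversed integral changes the sign of the potential. -/
theorem inner_adjointSolution {n : ℕ} {ψ : L2I} {φ : ℝ → L2I}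
    (hφ : heatSystem.IsAdjointSolution n ψ φ) {t : ℝ} (ht : t ∈ Icc 0 (n * heatSystem.T)) (k : ℕ) :
    ⟪sinBasis k, φ t⟫_ℝ = Real.exp (prim (n * heatSystem.T) - prim t -
      lapEig k * (n * heatSystem.T - t)) * ⟪sinBasis k, ψ⟫_ℝ := by
  obtain ⟨S, hS, hφc, heq⟩ := hφ
  set N : ℝ := n * heatSystem.T with hN
  have hN0 : 0 ≤ N := ht.1.trans ht.2
  have hc : ∀ τ ∈ Icc 0 N, Real.exp (lapEig k * (N - τ)) * ⟪sinBasis k, φ τ⟫_ℝ =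
      ⟪sinBasis k, ψ⟫_ℝ + ∫ r in N..τ, -(3 * Real.sin r ^ 2) *
        (Real.exp (lapEig k * (N - r)) * ⟪sinBasis k, φ r⟫_ℝ) := by
    intro τ hτ
    have hsub : Icc τ N ⊆ Icc 0 N := Icc_subset_Icc_left hτ.1
    have h1 : ∫ r in τ..N, (S (r - τ)).adjoint ((heatSystem.D r).adjoint (φ r)) =
        ∫ r in τ..N, heatSemigroup (r - τ) ((3 * Real.sin r ^ 2) • φ r) :=
      intervalIntegral.integral_congr fun r hr => by
        rw [uIcc_of_le hτ.2] at hr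
        rw [hS.eq_heatSemigroup (sub_nonneg.2 hr.1), adjoint_diagonalSemigroup lapEig_nonneg,
          adjoint_heatSystem_D_apply]
    have h2 : ContinuousOn (fun r => heatSemigroup (r - τ) ((3 * Real.sin r ^ 2) • φ r))
        (uIcc τ N) := by
      rw [uIcc_of_le hτ.2]
      refine continuousOn_diagonalSemigroup lapEig_nonneg (by fun_prop) ?_
      exact continuous_potential.continuousOn.smul (hφc.mono hsub)
    rw [heq τ hτ, h1, hS.eq_heatSemigroup (sub_nonneg.2 hτ.2),
      adjoint_diagonalSemigroup lapEig_nonneg, inner_add_right,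
      inner_intervalIntegral _ h2.intervalIntegrable, mul_add,
      inner_diagonalSemigroup_of_nonneg lapEig_nonneg (sub_nonneg.2 hτ.2), ← mul_assoc,
      ← Real.exp_add, ← intervalIntegral.integral_const_mul]
    congr 1
    · rw [neg_mul, add_neg_cancel, Real.exp_zero, one_mul]
    · rw [intervalIntegral.integral_symm τ N, ← intervalIntegral.integral_neg]
      refine intervalIntegral.integral_congr fun r hr => ?_
      rw [uIcc_of_le hτ.2] at hr
      rw [inner_diagonalSemigroup_of_nonneg lapEig_nonneg (sub_nonneg.2 hr.1), inner_smul_right,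
        ← mul_assoc, ← Real.exp_add,
        show lapEig k * (N - τ) + -lapEig k * (r - τ) = lapEig k * (N - r) by ring]
      ring
  have h := eq_mul_exp_of_volterra (d := fun r => -(3 * Real.sin r ^ 2)) (by fun_prop)
    (fun r => (hasDerivAt_prim r).neg) (right_mem_Icc.2 hN0)
    (ψ := fun r => Real.exp (lapEig k * (N - r)) * ⟪sinBasis k, φ r⟫_ℝ)
    (ContinuousOn.mul (by fun_prop) (continuousOn_const.inner hφc)) hc ht
  simp only [Pi.neg_apply] at h
  rw [show prim N - prim t - lapEig k * (N - t) = (-prim t - -prim N) + -(lapEig k * (N - t)) by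
    ring, Real.exp_add, mul_right_comm, mul_comm (Real.exp _), ← h, mul_right_comm, ← Real.exp_add,
    add_neg_cancel, Real.exp_zero, one_mul]

/-! ### Detectability -/

theorem adjoint_heatSystem_B_apply (t : ℝ) (z : L2I) :
    (heatSystem.B t).adjoint z = nrm⁻¹ * ⟪sinBasis 0, z⟫_ℝ := by
  refine ext_inner_left ℝ fun w => ?_
  rw [ContinuousLinearMap.adjoint_inner_right]
  simp only [heatSystem, ContinuousLinearMap.toSpanSingleton_apply, sinL2_eq, ← sinBasis_apply,
    real_inner_smul_left]
  exact mul_comm _ _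

theorem norm_le_abs_inner_add (z : L2I) {C : ℝ} {w : L2I} (hC : 0 ≤ C)
    (h : ∀ k, k ≠ 0 → |⟪sinBasis k, z⟫_ℝ| ≤ C * |⟪sinBasis k, w⟫_ℝ|) :
    ‖z‖ ≤ C * ‖w‖ + |⟪sinBasis 0, z⟫_ℝ| := by
  have h1 : ‖z - ⟪sinBasis 0, z⟫_ℝ • sinBasis 0‖ ≤ C * ‖w‖ := by
    refine norm_le_of_abs_inner_le sinBasis hC fun k => ?_
    rw [inner_sub_right, inner_smul_right, hilbertBasis_inner_self]
    by_cases hk : k = 0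
    · rw [hk, if_pos rfl, mul_one, sub_self, abs_zero]
      positivity
    · rw [if_neg hk, mul_zero, sub_zero]
      exact h k hk
  have h2 : ‖⟪sinBasis 0, z⟫_ℝ • sinBasis 0‖ = |⟪sinBasis 0, z⟫_ℝ| := by
    rw [norm_smul, sinBasis.orthonormal.1 0, mul_one, Real.norm_eq_abs]
  calc ‖z‖ = ‖(z - ⟪sinBasis 0, z⟫_ℝ • sinBasis 0) + ⟪sinBasis 0, z⟫_ℝ • sinBasis 0‖ := by
        rw [sub_add_cancel]
    _ ≤ _ := (norm_add_le _ _).trans (by rw [h2]; gcongr)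

/-- Higher modes contract by more than `exp (-π)` on their own; mode 0, which is amplified by `exp
(π / 2)`, is recovered from the observation. -/
theorem detectabilityInequality_heatSystem :
    heatSystem.DetectabilityInequality (Real.exp (-Real.pi)) 1 (2 * Real.exp (2 * Real.pi)) := by
  intro ψ φ hφ
  have hT : ((1 : ℕ) : ℝ) * heatSystem.T = Real.pi := by simp [heatSystem]
  have hpi := Real.pi_pos
  have hc := fun t ht k => inner_adjointSolution hφ (t := t) ht k
  have hφc : ContinuousOn φ (Icc 0 Real.pi) := by
    obtain ⟨S, -, h, -⟩ := hφ
    rwa [hT] at h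
  rw [hT] at hc ⊢
  have hmem : (0 : ℝ) ∈ Icc 0 Real.pi := ⟨le_rfl, hpi.le⟩
  have h0 : |⟪sinBasis 0, φ 0⟫_ℝ| = Real.exp (Real.pi / 2) * |⟪sinBasis 0, ψ⟫_ℝ| := by
    rw [hc 0 hmem, abs_mul, Real.abs_exp, prim_pi, prim_zero, lapEig_zero]
    ring_nf
  have h1 : ‖φ 0‖ ≤ Real.exp (-Real.pi) * ‖ψ‖ + |⟪sinBasis 0, φ 0⟫_ℝ| := by
    refine norm_le_abs_inner_add _ (Real.exp_pos _).le fun k hk => ?_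
    rw [hc 0 hmem, abs_mul, Real.abs_exp, prim_pi, prim_zero]
    -- The exponent is at most `3π/2 - 4π = -5π/2`, well below `-π`.
    have := four_le_lapEig hk
    gcongr
    nlinarith
  refine h1.trans (add_le_add le_rfl ?_)
  rw [h0]
  have h2 : (Real.exp (-Real.pi) * |⟪sinBasis 0, ψ⟫_ℝ|) ^ 2 ≤
      ∫ t in (0 : ℝ)..Real.pi, ‖(heatSystem.B t).adjoint (φ t)‖ ^ 2 := by
    have hlow : ∀ t ∈ Icc 0 Real.pi, (Real.exp (-Real.pi) * |⟪sinBasis 0, ψ⟫_ℝ|) ^ 2 / Real.pi ≤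
        ‖(heatSystem.B t).adjoint (φ t)‖ ^ 2 := fun t ht => by
      rw [adjoint_heatSystem_B_apply, hc t ht, Real.norm_eq_abs, sq_abs, mul_pow nrm⁻¹, inv_pow,
        sq nrm, nrm_sq, inv_div, mul_pow, mul_pow, sq_abs, lapEig_zero, div_eq_inv_mul]
      have hm := monotone_prim ht.2
      -- `π / 2` is the squared norm of `sin`, coming from `nrm⁻¹ ^ 2`; it beats the `1 / π` that
      -- spreads the lower bound over the interval.
      have h3 : Real.pi⁻¹ ≤ Real.pi / 2 := by
        rw [inv_le_iff_one_le_mul₀ hpi]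
        nlinarith [Real.pi_gt_three]
      have h4 : -Real.pi ≤ prim Real.pi - prim t - 1 * (Real.pi - t) := by linarith [ht.1]
      gcongr
    have hcont : ContinuousOn (fun t => ‖(heatSystem.B t).adjoint (φ t)‖ ^ 2) (uIcc 0 Real.pi) := by
      simp only [adjoint_heatSystem_B_apply]
      rw [uIcc_of_le hpi.le]
      exact ((continuousOn_const.mul (continuousOn_const.inner hφc)).norm).pow 2
    calc (Real.exp (-Real.pi) * |⟪sinBasis 0, ψ⟫_ℝ|) ^ 2
        = ∫ _ in (0 : ℝ)..Real.pi, (Real.exp (-Real.pi) * |⟪sinBasis 0, ψ⟫_ℝ|) ^ 2 / Real.pi := by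
          rw [intervalIntegral.integral_const, smul_eq_mul, sub_zero, mul_div_cancel₀ _ hpi.ne']
      _ ≤ _ := intervalIntegral.integral_mono_on hpi.le (by simp) hcont.intervalIntegrable hlow
  have h3 := Real.le_sqrt_of_sq_le h2
  calc Real.exp (Real.pi / 2) * |⟪sinBasis 0, ψ⟫_ℝ|
      ≤ 2 * Real.exp (2 * Real.pi) * (Real.exp (-Real.pi) * |⟪sinBasis 0, ψ⟫_ℝ|) := by
        rw [mul_assoc, ← mul_assoc (Real.exp _), ← Real.exp_add, ← mul_assoc]
        gcongr
        have : Real.exp (Real.pi / 2) ≤ Real.exp (2 * Real.pi + -Real.pi) := by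
          gcongr
          linarith
        linarith [Real.exp_pos (Real.pi / 2)]
    _ ≤ _ := by gcongr

/-! ### Stabilization -/

/-- The decay rates of the closed-loop system. -/
def closedLoopRate (k : ℕ) : ℝ := lapEig k + if k = 0 then 1 else 0

theorem two_le_closedLoopRate (k : ℕ) : 2 ≤ closedLoopRate k := by
  rw [closedLoopRate]
  split_ifs with h
  · rw [h, lapEig_zero]
    norm_num
  · linarith [four_le_lapEig h]

theorem closedLoopRate_nonneg (k : ℕ) : 0 ≤ closedLoopRate k := by
  linarith [two_le_closedLoopRate k]

theorem isPeriodicallyStabilizable_heatSystem : heatSystem.IsPeriodicallyStabilizable := by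
  -- Since `sinL2 = nrm⁻¹ • sinVec 0`, the factor `-nrm` makes `B K` minus the projection onto mode
  -- 0. The two errors `3/4` of `prim` give `M = exp (3/2)`, and the slowest closed-loop rate gives
  -- the decay `2 - 3/2 = 1/2`.
  refine ⟨fun _ => -nrm • innerSL ℝ (sinBasis 0), memLp_top_const _,
    Eventually.of_forall fun _ => rfl, diagonalEvolution closedLoopRate, ?_,
    Real.exp (3 / 2), Real.exp_pos _, 1 / 2, by norm_num, fun t s _ hst z => ?_⟩
  · have hBK : Continuous fun t : ℝ => (heatSystem.B t).comp (-nrm • innerSL ℝ (sinBasis 0)) :=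
      continuous_const (y := (heatSystem.B 0).comp (-nrm • innerSL ℝ (sinBasis 0)))
    refine isEvolutionSystem_diagonalEvolution closedLoopRate_nonneg
      (continuous_heatSystem_D.add hBK) fun r k z => ?_
    rw [add_apply, inner_add_right, heatSystem_D_apply, inner_smul_right,
      add_mul, add_right_inj, closedLoopRate]
    simp only [heatSystem, ContinuousLinearMap.comp_apply, smul_apply,
      ContinuousLinearMap.toSpanSingleton_apply, sinL2_eq, ← sinBasis_apply, innerSL_apply_apply,
      inner_smul_right, hilbertBasis_inner_self, smul_eq_mul]
    split_ifs with h
    · rw [h]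
      field_simp [nrm_pos.ne']
      ring
    · simp
  · rw [mul_comm (Real.exp (3 / 2)), ← Real.exp_add]
    refine norm_le_of_abs_inner_le sinBasis (Real.exp_pos _).le fun k => ?_
    rw [inner_diagonalEvolution closedLoopRate_nonneg hst, abs_mul, Real.abs_exp]
    have h1 := (abs_le.1 (abs_prim_sub_le t)).2
    have h2 := (abs_le.1 (abs_prim_sub_le s)).1
    have h3 := mul_le_mul_of_nonneg_right (two_le_closedLoopRate k) (sub_nonneg.2 hst)
    gcongr
    linarith

end PeriodicStab

end

open PeriodicStab in
theorem mainTheorem3 :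
    -- the system fits the periodic setting and is well posed, together with its adjoint equations
    heatSystem.IsPeriodic ∧
    (∃ Φ : ℝ → ℝ → L2I →L[ℝ] L2I, heatSystem.IsEvolution Φ) ∧
    (∀ (n : ℕ) (ψ : L2I), 1 ≤ n → ∃ φ : ℝ → L2I, heatSystem.IsAdjointSolution n ψ φ) ∧
    -- with zero control it is not stable, and indeed has a solution that blows up at infinity
    ¬ IsStable heatSystem.A heatSystem.D ∧
    (∀ Φ : ℝ → ℝ → L2I →L[ℝ] L2I, heatSystem.IsEvolution Φ →
      ∃ z : L2I, Tendsto (fun t : ℝ => ‖heatSystem.solution Φ t 0 z (fun _ => 0)‖) atTop atTop) ∧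
    -- it is not null controllable
    ¬ heatSystem.IsNullControllable ∧
    -- the detectability inequality
    (Real.exp (-Real.pi) ∈ Ioo (0 : ℝ) 1 ∧
      heatSystem.DetectabilityInequality (Real.exp (-Real.pi)) 1 (2 * Real.exp (2 * Real.pi))) ∧
    -- periodic stabilizability
    heatSystem.IsPeriodicallyStabilizable :=
  ⟨isPeriodic_heatSystem, ⟨_, isEvolution_diagonalEvolution⟩,
    fun n ψ _ => exists_isAdjointSolution n ψ, not_isStable_heatSystem,
    fun _ hΦ => ⟨_, tendsto_norm_solution hΦ⟩, not_isNullControllable_heatSystem,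
    ⟨⟨Real.exp_pos _, Real.exp_lt_one_iff.2 (neg_lt_zero.2 Real.pi_pos)⟩,
      detectabilityInequality_heatSystem⟩,
    isPeriodicallyStabilizable_heatSystem⟩
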